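/- Let $\mathbb T=\mathbb R/2\pi\mathbb Z$, $\alpha\in\mathbb R$, $q\in\mathbb N$ and $Q=(Q_0,\dots,Q_{q-1})\in C^\infty(\mathbb T;\mathbb R^q)$. For $\psi_0\in L^2(\mathbb T)=L^2(\mathbb T;\mathbb C)$ and a control $u:(0,t)\to\mathbb R^q$, let $R_t(\psi_0,u):=\psi(t)$, where $\psi\in C([0,t];L^2(\mathbb T))$ is the solution (in the sense of distributions) of $$\partial_t\psi+\partial_x^3\psi-i\alpha\,\partial_x^2\psi=i(u\cdot Q)\psi,\qquad \psi(0,\cdot)=\psi_0 .$$ Let $\psi_0\in L^2(\mathbb T)$, let $u\in\mathbb R^q$ be a constant vector and let $\varphi\in C^3(\mathbb T;\mathbb R)$. Then for every $\tau>0$ the equation with initial datum $e^{-i\tau^{-1/3}\varphi}\psi_0$ and constant control $\tau^{-1}u$ has exactly one solution in $C([0,\tau];L^2(\mathbb T))$, and $$e^{i\tau^{-1/3}\varphi}\,R_\tau\bigl(e^{-i\tau^{-1/3}\varphi}\psi_0,\ \tau^{-1}u\bigr)\ \longrightarrow\ e^{-i(\varphi')^3+i(u\cdot Q)}\,\psi_0\quad\text{in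 }L^2(\mathbb T)\text{ as }\tau\to0^+ .$$ -/

import Mathlib

open MeasureTheory Set Filter Topology

noncomputable section

namespace KdVSch

instance fact_two_pi_pos : Fact ((0 : ℝ) < 2 * Real.pi) := ⟨Real.two_pi_pos⟩

/-- The torus `ℝ / 2πℤ`. -/
abbrev Torus : Type := AddCircle (2 * Real.pi)

/-- The measure `dx / 2π` on the torus. -/
abbrev μT : Measure Torus := AddCircle.haarAddCircle

/-- The complex Hilbert space `L²(𝕋)`. -/
abbrev L2T : Type := Lp ℂ 2 μT

/-- `f` is of class `C^n` on the torus: its `2π`-periodic lift to `ℝ` is. -/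
def TorusContDiff {E : Type*} [NormedAddCommGroup E] [NormedSpace ℝ E]
    (n : WithTop ℕ∞) (f : Torus → E) : Prop :=
  ContDiff ℝ n (fun x : ℝ => f (x : Torus))

/-- The derivative `f'` of a function on the torus. -/
def torusDeriv {E : Type*} [NormedAddCommGroup E] [NormedSpace ℝ E]
    (f : Torus → E) (x : Torus) : E :=
  deriv (fun h : ℝ => f (x + (h : Torus))) 0

/-- The function `(u · Q)(x) = ∑ⱼ uⱼ Qⱼ(x)`. -/
def dotQ {q : ℕ} (Q : Fin q → Torus → ℝ) (u : Fin q → ℝ) (x : Torus) : ℝ :=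
  ∑ j, u j * Q j x

/-- `ψ` (on `[0, T]`) is a solution in `C([0,T]; L²(𝕋))` of
`∂ₜψ + ∂ₓ³ψ - iα ∂ₓ²ψ = i (u(t) · Q) ψ`, `ψ(0) = ψ₀`, the equation being understood in the sense
of distributions: it is tested against every smooth function `θ` on the torus
(with the bilinear pairing `∫ ψ θ`) and integrated in time from `0` to `t`, for every
`t ∈ [0, T]`. The control `u` is taken to be locally bounded and measurable, e.g. piecewise
constant. -/
structure IsSolution {q : ℕ} (α : ℝ) (Q : Fin q → Torus → ℝ) (u : ℝ → Fin q → ℝ) (T : ℝ)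
    (ψ₀ : L2T) (ψ : ℝ → L2T) : Prop where
  continuousOn : ContinuousOn ψ (Icc 0 T)
  initial : ψ 0 = ψ₀
  weak : ∀ θ : Torus → ℂ, TorusContDiff (⊤ : ℕ∞) θ → ∀ t ∈ Icc 0 T,
    ∫ x, ψ t x * θ x ∂μT =
      ∫ x, ψ₀ x * θ x ∂μT +
      ∫ s in (0 : ℝ)..t, ∫ x, ψ s x *
        (torusDeriv (torusDeriv (torusDeriv θ)) x
          + Complex.I * (α : ℂ) * torusDeriv (torusDeriv θ) x
          + Complex.I * (dotQ Q (u s) x : ℂ) * θ x) ∂μT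

/-- On `[0, T]` there is a solution, and any two solutions agree there. -/
def WellPosed {q : ℕ} (α : ℝ) (Q : Fin q → Torus → ℝ) (u : ℝ → Fin q → ℝ) (T : ℝ)
    (ψ₀ : L2T) : Prop :=
  ∃ ψ : ℝ → L2T, IsSolution α Q u T ψ₀ ψ ∧
    ∀ ψ' : ℝ → L2T, IsSolution α Q u T ψ₀ ψ' → EqOn ψ' ψ (Icc 0 T)

open Classical in
/-- `R_t(ψ₀, u)`: the value at time `t` of the solution on `[0, t]` with initial datum `ψ₀` and
control `u` (the value is `0` if there were no solution). -/
def R {q : ℕ} (α : ℝ) (Q : Fin q → Torus → ℝ) (t : ℝ) (ψ₀ : L2T) (u : ℝ → Fin q → ℝ) : L2T :=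
  if h : ∃ ψ : ℝ → L2T, IsSolution α Q u t ψ₀ ψ then h.choose t else 0

/-- A phase multiplication of an `L²` function is in `L²`. -/
theorem memLp_phase {θ : Torus → ℝ} (hθ : Measurable θ) (f : L2T) :
    MemLp (fun x => Complex.exp (Complex.I * (θ x : ℂ)) * f x) 2 μT := by
  refine (Lp.memLp f).congr_norm ?_ (ae_of_all _ fun x => ?_)
  · exact (Complex.measurable_exp.comp
      ((Complex.measurable_ofReal.comp hθ).const_mul _)).aestronglyMeasurable.mul
      (Lp.memLp f).aestronglyMeasurable
  · rw [norm_mul, mul_comm Complex.I, Complex.norm_exp_ofReal_mul_I, one_mul]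

open Classical in
/-- The element `e^{iθ} f` of `L²(𝕋)`, for a real measurable phase `θ`. -/
def phaseMul (θ : Torus → ℝ) (f : L2T) : L2T :=
  if h : MemLp (fun x => Complex.exp (Complex.I * (θ x : ℂ)) * f x) 2 μT then h.toLp _ else 0

theorem phaseMul_ae {θ : Torus → ℝ} (hθ : Measurable θ) (f : L2T) :
    phaseMul θ f =ᵐ[μT] fun x => Complex.exp (Complex.I * (θ x : ℂ)) * f x := by
  rw [phaseMul, dif_pos (memLp_phase hθ f)]
  exact MemLp.coeFn_toLp _

end KdVSch

end

/-! Write `κ = τ^(1/3)` and `V = u · Q`. Conjugating by `e^{-iφ/κ}` turns `∂ₓ` into `∂ₓ - iφ'/κ`.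
The leading part of `∂ₓ³` becomes multiplication by `iφ'³/κ³`, of the same size as the control
`iV/κ³`; all other terms are `O(κ⁻²)` on smooth functions. Over a time `κ³` they contribute `O(κ)`,
so the limit is the flow at time `1` of multiplication by `i(V - φ'³)`.

This is made rigorous with the approximate solution `w(t) = exp(i(-φ/κ + tG/κ³)) f`. Here `f` is a
trigonometric polynomial near `ψ₀`, and `G = g + V` with `g` smooth and uniformly near `-φ'³`. The
replacement of `-φ'³` is needed because `w` must have three derivatives, while `φ'³` has in general
only two. The residual is at most `(η + κC)/κ³`, with `C` independent of `κ`
(`conjugated_operator_expansion`, `exists_phaseRemainder_bound`). The potential has norm at most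
`M/κ³`, so Gronwall on `[0, κ³]` loses only a factor depending on `M`
(`exists_oscillating_estimate`, `gronwallBound_rescaled`). Then `κ → 0` for fixed `f`, `g`.

The stability estimate must hold for distributional `L²` solutions. These are characterised by their
Fourier coordinates (`isSolution_iff_solvesDiag`), hence by Duhamel's formula. Undoing the free
unitary group removes the unbounded generator and leaves a bounded linear ODE, which gives
existence, uniqueness and stability. -/

noncomputable section

namespace KdVSch

/-! ### Unitary groups diagonal in a Hilbert basis. -/

section DiagonalGroup

variable {ι H : Type*} [NormedAddCommGroup H] [InnerProductSpace ℂ H]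

theorem norm_cexp_I_mul_ofReal (x : ℝ) : ‖Complex.exp (Complex.I * (x : ℂ))‖ = 1 := by
  rw [mul_comm, Complex.norm_exp_ofReal_mul_I]

theorem memℓp_phase (θ : ι → ℝ) (f : lp (fun _ : ι => ℂ) 2) :
    Memℓp (fun n => Complex.exp (Complex.I * (θ n : ℂ)) * f n) 2 := by
  refine memℓp_gen ?_
  have h := (lp.memℓp f).summable (p := 2) (by norm_num)
  refine h.congr fun n => ?_
  rw [norm_mul, norm_cexp_I_mul_ofReal, one_mul]

/-- The isometry of `ℓ²` multiplying each coordinate by a phase. -/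
def phaseDiag (θ : ι → ℝ) : lp (fun _ : ι => ℂ) 2 →ₗᵢ[ℂ] lp (fun _ : ι => ℂ) 2 where
  toFun f := ⟨fun n => Complex.exp (Complex.I * (θ n : ℂ)) * f n, memℓp_phase θ f⟩
  map_add' f g := by
    ext n
    exact mul_add _ _ _
  map_smul' c f := by
    ext n
    simp [mul_left_comm]
  norm_map' f := by
    have h2 : 0 < (2 : ENNReal).toReal := by norm_num
    rw [← Real.rpow_left_inj (norm_nonneg _) (norm_nonneg _) h2.ne',
      lp.norm_rpow_eq_tsum h2, lp.norm_rpow_eq_tsum h2]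
    refine tsum_congr fun n => ?_
    simp only [LinearMap.coe_mk, AddHom.coe_mk, norm_mul, norm_cexp_I_mul_ofReal, one_mul]

/-- The unitary group whose generator is diagonal in the basis `b`, with eigenvalues `i ω n`. -/
def diagGroup (b : HilbertBasis ι ℂ H) (ω : ι → ℝ) (t : ℝ) : H →ₗᵢ[ℂ] H :=
  b.repr.symm.toLinearIsometry.comp
    ((phaseDiag fun n => t * ω n).comp b.repr.toLinearIsometry)

variable (b : HilbertBasis ι ℂ H) (ω : ι → ℝ)

@[simp]
theorem repr_diagGroup (t : ℝ) (f : H) (n : ι) :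
    b.repr (diagGroup b ω t f) n
      = Complex.exp (Complex.I * ((t * ω n : ℝ) : ℂ)) * b.repr f n := by
  simp [diagGroup, phaseDiag]

theorem repr_ext {f g : H} (h : ∀ n, b.repr f n = b.repr g n) : f = g :=
  b.repr.injective (by ext n; exact h n)

theorem diagGroup_zero (f : H) : diagGroup b ω 0 f = f :=
  repr_ext b fun n => by simp

/-- The vectors with a continuous orbit form a subspace containing the basis. It is closed because
isometries turn approximation of the vector into approximation of the orbit, uniformly in time. -/
theorem continuous_diagGroup_apply (f : H) : Continuous fun t => diagGroup b ω t f := by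
  have hclosed : IsClosed {f : H | Continuous fun t => diagGroup b ω t f} := by
    refine isClosed_of_closure_subset fun f hf => ?_
    refine continuous_of_uniform_approx_of_continuous fun u hu => ?_
    obtain ⟨ε, hε, hu⟩ := Metric.mem_uniformity_dist.1 hu
    obtain ⟨g, hg, hfg⟩ := Metric.mem_closure_iff.1 hf ε hε
    exact ⟨_, hg, fun t => hu (by rwa [(diagGroup b ω t).dist_map])⟩
  have hspan : ((Submodule.span ℂ (Set.range b) : Submodule ℂ H) : Set H)
      ⊆ {f : H | Continuous fun t => diagGroup b ω t f} := by
    intro f hf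
    induction hf using Submodule.span_induction with
    | mem x hx =>
      obtain ⟨n, rfl⟩ := hx
      have : (fun t => diagGroup b ω t (b n))
          = fun t : ℝ => Complex.exp (Complex.I * ((t * ω n : ℝ) : ℂ)) • b n := by
        funext t
        refine repr_ext b fun m => ?_
        classical
        by_cases hm : m = n
        · subst hm; simp
        · simp [b.repr_self, Pi.single_eq_of_ne hm]
      rw [mem_ofPred_eq, this]
      fun_prop
    | zero => simpa using continuous_const
    | add x y _ _ hx hy =>
      simp only [mem_ofPred_eq, map_add] at hx hy ⊢
      exact hx.add hy
    | smul c x _ hx =>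
      simp only [mem_ofPred_eq, map_smul] at hx ⊢
      exact hx.const_smul c
  have hd : closure ((Submodule.span ℂ (Set.range b) : Submodule ℂ H) : Set H) = univ := by
    rw [← Submodule.topologicalClosure_coe, b.dense_span]; rfl
  have := hclosed.closure_subset_iff.2 hspan
  rw [hd] at this
  exact this (mem_univ f)

theorem continuous_diagGroup_uncurry : Continuous fun p : ℝ × H => diagGroup b ω p.1 p.2 := by
  refine continuous_iff_continuousAt.2 fun ⟨t, f⟩ => ?_
  rw [ContinuousAt, tendsto_iff_dist_tendsto_zero]
  have h1 : Tendsto (fun p : ℝ × H => dist p.2 f + dist (diagGroup b ω p.1 f) (diagGroup b ω t f))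
      (𝓝 (t, f)) (𝓝 0) := by
    have : Continuous fun p : ℝ × H =>
        dist p.2 f + dist (diagGroup b ω p.1 f) (diagGroup b ω t f) :=
      (continuous_snd.dist continuous_const).add
        (((continuous_diagGroup_apply b ω f).comp continuous_fst).dist continuous_const)
    simpa using this.tendsto (t, f)
  refine squeeze_zero (fun _ => dist_nonneg) (fun p => ?_) h1
  refine (dist_triangle _ (diagGroup b ω p.1 f) _).trans ?_
  rw [(diagGroup b ω p.1).dist_map]

theorem continuousOn_diagGroup {F : ℝ → H} {s : Set ℝ} {c : ℝ → ℝ} (hc : Continuous c)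
    (hF : ContinuousOn F s) :
    ContinuousOn (fun t => diagGroup b ω (c t) (F t)) s :=
  have h : ContinuousOn (fun t => (c t, F t)) s := hc.continuousOn.prodMk hF
  (continuous_diagGroup_uncurry b ω).comp_continuousOn (f := fun t => (c t, F t)) h

end DiagonalGroup

/-! ### Linear equations with strongly continuous bounded coefficients. -/

section LinearODE

/-- The radial retraction onto the closed ball of radius `r`. -/
def radialRetract {E : Type*} [NormedAddCommGroup E] [NormedSpace ℝ E] (r : ℝ) (x : E) : E :=
  (min 1 (r / ‖x‖)) • x

variable {E : Type*} [NormedAddCommGroup E] [NormedSpace ℝ E]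

theorem radialRetract_of_norm_le {r : ℝ} {x : E} (h : ‖x‖ ≤ r) : radialRetract r x = x := by
  rcases eq_or_ne x 0 with rfl | hx
  · simp [radialRetract]
  · have : 1 ≤ r / ‖x‖ := (one_le_div (norm_pos_iff.2 hx)).2 h
    rw [radialRetract, min_eq_left this, one_smul]

theorem radialRetract_of_le_norm {r : ℝ} {x : E} (hr : 0 < r) (h : r ≤ ‖x‖) :
    radialRetract r x = (r / ‖x‖) • x := by
  rw [radialRetract, min_eq_right ((div_le_one (hr.trans_le h)).2 h)]

theorem norm_radialRetract_le {r : ℝ} (hr : 0 < r) (x : E) : ‖radialRetract r x‖ ≤ r := by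
  rcases le_total ‖x‖ r with h | h
  · rwa [radialRetract_of_norm_le h]
  · have hx : 0 < ‖x‖ := hr.trans_le h
    rw [radialRetract_of_le_norm hr h, norm_smul, Real.norm_of_nonneg (by positivity),
      div_mul_cancel₀ _ hx.ne']

theorem norm_radialRetract_le_norm {r : ℝ} (hr : 0 < r) (x : E) : ‖radialRetract r x‖ ≤ ‖x‖ := by
  rcases le_total ‖x‖ r with h | h
  · rw [radialRetract_of_norm_le h]
  · exact (norm_radialRetract_le hr x).trans h

/-- Gives the truncated field a global Lipschitz constant. The factor `2` comes from the triangle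
inequality alone and needs no inner product. -/
theorem norm_radialRetract_sub_le {r : ℝ} (hr : 0 < r) (x y : E) :
    ‖radialRetract r x - radialRetract r y‖ ≤ 2 * ‖x - y‖ := by
  wlog hxy : ‖x‖ ≤ ‖y‖ generalizing x y
  · rw [norm_sub_rev, norm_sub_rev x]
    exact this y x (le_of_not_ge hxy)
  have hd : ‖y‖ - ‖x‖ ≤ ‖x - y‖ := by
    rw [norm_sub_rev]
    exact norm_sub_norm_le y x
  rcases le_total ‖y‖ r with hy | hy
  · rw [radialRetract_of_norm_le hy, radialRetract_of_norm_le (hxy.trans hy)]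
    linarith [norm_nonneg (x - y)]
  have hy0 : 0 < ‖y‖ := hr.trans_le hy
  have hc : r / ‖y‖ ≤ 1 := (div_le_one hy0).2 hy
  rcases le_total ‖x‖ r with hx | hx
  · rw [radialRetract_of_norm_le hx, radialRetract_of_le_norm hr hy]
    have e : x - (r / ‖y‖) • y = (x - y) + (1 - r / ‖y‖) • y := by
      rw [sub_smul, one_smul]; abel
    rw [e]
    refine (norm_add_le _ _).trans ?_
    rw [norm_smul, Real.norm_of_nonneg (by linarith), sub_mul, one_mul,
      div_mul_cancel₀ _ hy0.ne']
    linarith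
  · have hx0 : 0 < ‖x‖ := hr.trans_le hx
    have hcx : r / ‖x‖ ≤ 1 := (div_le_one hx0).2 hx
    have hle : r / ‖y‖ ≤ r / ‖x‖ := div_le_div_of_nonneg_left hr.le hx0 hxy
    rw [radialRetract_of_le_norm hr hx, radialRetract_of_le_norm hr hy]
    have e : (r / ‖x‖) • x - (r / ‖y‖) • y
        = (r / ‖x‖) • (x - y) + (r / ‖x‖ - r / ‖y‖) • y := by
      rw [sub_smul, smul_sub]; abel
    rw [e]
    refine (norm_add_le _ _).trans ?_
    rw [norm_smul, norm_smul, Real.norm_of_nonneg (by positivity),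
      Real.norm_of_nonneg (by linarith)]
    have e2 : (r / ‖x‖ - r / ‖y‖) * ‖y‖ = (r / ‖x‖) * (‖y‖ - ‖x‖) := by
      field_simp
    rw [e2]
    have h0 : 0 ≤ r / ‖x‖ := by positivity
    nlinarith [mul_le_mul_of_nonneg_left hd h0,
      mul_le_mul_of_nonneg_right hcx (norm_nonneg (x - y))]

/-- Global existence for a linear equation whose bounded coefficient is strongly continuous. -/
theorem exists_linear_ode_solution [CompleteSpace E] {A : ℝ → E →L[ℝ] E} {M T : ℝ} (hT : 0 ≤ T)
    (hA : ∀ x, Continuous fun t => A t x) (hM : ∀ t, ‖A t‖ ≤ M) (x₀ : E) :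
    ∃ z : ℝ → E, z 0 = x₀ ∧
      ∀ t ∈ Icc 0 T, HasDerivWithinAt z (A t (z t)) (Icc 0 T) t := by
  have hM0 : 0 ≤ M := (norm_nonneg _).trans (hM 0)
  -- Truncating at radius `r` bounds the field by `M * r`, so Picard–Lindelöf covers `[0, T]` in one
  -- step with radius `M * r * T`. Gronwall then keeps the solution below `‖x₀‖ e^{MT}`, where the
  -- truncation is inactive; the `1` makes `r` positive even if `x₀ = 0`.
  set r : ℝ := ‖x₀‖ * Real.exp (M * T) + 1 with hr
  have hr0 : 0 < r := by positivity
  have hP : IsPicardLindelof (fun t x => A t (radialRetract r x)) (tmin := 0) (tmax := T)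
      ⟨0, le_rfl, hT⟩ x₀ (NNReal.mk (M * r * T) (by positivity)) 0
      (NNReal.mk (M * r) (by positivity))
      (NNReal.mk (M * 2) (by positivity)) := by
    refine ⟨fun t _ => ?_, fun x _ => (hA _).continuousOn, fun t _ x _ => ?_, ?_⟩
    · refine LipschitzOnWith.of_dist_le_mul fun x _ y _ => ?_
      rw [dist_eq_norm, dist_eq_norm, ← map_sub]
      refine ((A t).le_opNorm _).trans ?_
      refine (mul_le_mul (hM t) (norm_radialRetract_sub_le hr0 x y) (norm_nonneg _) hM0).trans ?_
      exact le_of_eq (by rw [NNReal.coe_mk]; ring)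
    · exact ((A t).le_opNorm _).trans
        (mul_le_mul (hM t) (norm_radialRetract_le hr0 x) (norm_nonneg _) hM0)
    · simp [hT]
  obtain ⟨z, hz0, hz⟩ := hP.exists_eq_forall_mem_Icc_hasDerivWithinAt₀
  refine ⟨z, hz0, fun t ht => ?_⟩
  have hb := norm_le_gronwallBound_of_norm_deriv_right_le (f := z)
    (f' := fun t => A t (radialRetract r (z t))) (δ := ‖x₀‖) (K := M) (ε := 0) (a := 0) (b := T)
    (fun t ht => (hz t ht).continuousWithinAt)
    (fun t ht => ((hz t ⟨ht.1, ht.2.le⟩).mono_of_mem_nhdsWithin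
      (Icc_mem_nhdsGE_of_mem ht)))
    (le_of_eq (congrArg norm hz0))
    (fun t _ => by
      rw [add_zero]
      exact ((A t).le_opNorm _).trans
        (mul_le_mul (hM t) (norm_radialRetract_le_norm hr0 _) (norm_nonneg _) hM0)) t ht
  rw [sub_zero, gronwallBound_ε0] at hb
  have : ‖z t‖ ≤ r := by
    refine hb.trans ?_
    rw [hr]
    have : Real.exp (M * t) ≤ Real.exp (M * T) :=
      Real.exp_le_exp.2 (mul_le_mul_of_nonneg_left ht.2 hM0)
    have := mul_le_mul_of_nonneg_left this (norm_nonneg x₀)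
    linarith
  have h := hz t ht
  rwa [radialRetract_of_norm_le this] at h

end LinearODE

/-! ### Integral and differential forms of an equation on `[0, T]`. -/

section FundamentalTheorem

variable {E : Type*} [NormedAddCommGroup E] [NormedSpace ℝ E] [CompleteSpace E]

theorem hasDerivWithinAt_of_eq_integral {z g : ℝ → E} {z₀ : E} {T : ℝ}
    (hg : ContinuousOn g (Icc 0 T)) (hz : ∀ t ∈ Icc 0 T, z t = z₀ + ∫ s in (0 : ℝ)..t, g s)
    {t : ℝ} (ht : t ∈ Icc 0 T) : HasDerivWithinAt z (g t) (Icc 0 T) t := by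
  have h0 : (0 : ℝ) ∈ Icc 0 T := ⟨le_rfl, ht.1.trans ht.2⟩
  have : Fact (t ∈ Icc 0 T) := ⟨ht⟩
  refine HasDerivWithinAt.congr_of_mem (HasDerivWithinAt.const_add z₀ ?_) hz ht
  exact intervalIntegral.integral_hasDerivWithinAt_right
    (hg.mono (uIcc_subset_Icc h0 ht)).intervalIntegrable
    (hg.stronglyMeasurableAtFilter_nhdsWithin measurableSet_Icc t) (hg t ht)

theorem eq_integral_of_hasDerivWithinAt {z g : ℝ → E} {T : ℝ}
    (hg : ContinuousOn g (Icc 0 T)) (hz : ∀ t ∈ Icc 0 T, HasDerivWithinAt z (g t) (Icc 0 T) t)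
    {t : ℝ} (ht : t ∈ Icc 0 T) : z t = z 0 + ∫ s in (0 : ℝ)..t, g s := by
  have hsub : Icc 0 t ⊆ Icc 0 T := Icc_subset_Icc_right ht.2
  rw [intervalIntegral.integral_eq_sub_of_hasDerivAt_of_le (f := z) ht.1
    (fun s hs => ((hz s (hsub hs)).continuousWithinAt).mono hsub)
    (fun s hs => (hz s (hsub (Ioo_subset_Icc_self hs))).hasDerivAt
      (Icc_mem_nhds hs.1 (hs.2.trans_le ht.2)))
    (by
      refine (hg.mono ?_).intervalIntegrable
      rwa [uIcc_of_le ht.1])]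
  abel

end FundamentalTheorem

/-! ### Duhamel's formula, existence, stability and uniqueness. -/

section Duhamel

theorem hasDerivAt_cexp_I_mul (ω t : ℝ) :
    HasDerivAt (fun s : ℝ => Complex.exp (Complex.I * ((s * ω : ℝ) : ℂ)))
      (Complex.exp (Complex.I * ((t * ω : ℝ) : ℂ)) * (Complex.I * ω)) t := by
  have h1 : HasDerivAt (fun s : ℝ => ((s * ω : ℝ) : ℂ)) ((1 * ω : ℝ) : ℂ) t :=
    ((hasDerivAt_id t).mul_const ω).ofReal_comp
  simpa using (h1.const_mul Complex.I).cexp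

variable {ι H : Type*} [NormedAddCommGroup H] [InnerProductSpace ℂ H]

/-- The coordinate functionals of a Hilbert basis. -/
def coordL (b : HilbertBasis ι ℂ H) (n : ι) : H →L[ℂ] ℂ := innerSL ℂ (b n)

theorem coordL_apply (b : HilbertBasis ι ℂ H) (n : ι) (f : H) : coordL b n f = b.repr f n := by
  rw [b.repr_apply_apply]; rfl

/-- `ψ` solves `ψ' = i ω ψ + F` on `[0, T]`, coordinate by coordinate in the basis `b`. -/
def SolvesDiag (b : HilbertBasis ι ℂ H) (ω : ι → ℝ) (T : ℝ) (F ψ : ℝ → H) : Prop :=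
  ∀ n, ∀ t ∈ Icc 0 T, coordL b n (ψ t) = coordL b n (ψ 0) +
    ∫ s in (0 : ℝ)..t, (Complex.I * (ω n : ℂ) * coordL b n (ψ s) + coordL b n (F s))

variable (b : HilbertBasis ι ℂ H) (ω : ι → ℝ)

theorem coordL_diagGroup (t : ℝ) (f : H) (n : ι) :
    coordL b n (diagGroup b ω t f)
      = Complex.exp (Complex.I * ((t * ω n : ℝ) : ℂ)) * coordL b n f := by
  simp only [coordL_apply, repr_diagGroup]

variable {b ω} {T : ℝ} {F ψ : ℝ → H}

theorem continuousOn_coordL (b : HilbertBasis ι ℂ H) (hψ : ContinuousOn ψ (Icc 0 T)) (n : ι) :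
    ContinuousOn (fun t => coordL b n (ψ t)) (Icc 0 T) :=
  (coordL b n).continuous.comp_continuousOn hψ

theorem solvesDiag_diagGroup {z : ℝ → H} (hF : ContinuousOn F (Icc 0 T))
    (hz : ∀ t ∈ Icc 0 T, HasDerivWithinAt z (diagGroup b ω (-t) (F t)) (Icc 0 T) t) :
    SolvesDiag b ω T F (fun t => diagGroup b ω t (z t)) := by
  intro n t ht
  have hzc : ContinuousOn z (Icc 0 T) := fun t ht => (hz t ht).continuousWithinAt
  refine eq_integral_of_hasDerivWithinAt (T := T)
    (z := fun t => coordL b n (diagGroup b ω t (z t)))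
    (g := fun s => Complex.I * (ω n : ℂ) * coordL b n (diagGroup b ω s (z s)) + coordL b n (F s))
    ?_ (fun s hs => ?_) ht
  · exact (continuousOn_const.mul (continuousOn_coordL b
      (continuousOn_diagGroup b ω continuous_id hzc) n)).add (continuousOn_coordL b hF n)
  · have h1 : HasDerivWithinAt (fun s => coordL b n (z s))
        (coordL b n (diagGroup b ω (-s) (F s))) (Icc 0 T) s :=
      ((coordL b n).restrictScalars ℝ).hasFDerivAt.comp_hasDerivWithinAt s (hz s hs)
    simp only [coordL_diagGroup] at h1 ⊢
    refine ((hasDerivAt_cexp_I_mul (ω n) s).hasDerivWithinAt.mul h1).congr_deriv ?_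
    rw [← mul_assoc (Complex.exp _) (Complex.exp _), ← Complex.exp_add]
    push_cast
    rw [show Complex.I * (s * ω n) + Complex.I * (-s * ω n) = 0 by ring, Complex.exp_zero]
    ring

variable [CompleteSpace H]

theorem coordL_intervalIntegral {g : ℝ → H} (hg : ContinuousOn g (Icc 0 T)) {t : ℝ}
    (ht : t ∈ Icc 0 T) (n : ι) :
    coordL b n (∫ s in (0 : ℝ)..t, g s) = ∫ s in (0 : ℝ)..t, coordL b n (g s) := by
  refine ((coordL b n).intervalIntegral_comp_comm ?_).symm
  exact (hg.mono (uIcc_subset_Icc ⟨le_rfl, ht.1.trans ht.2⟩ ht)).intervalIntegrable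

/-- Duhamel's formula for a solution given by its coordinates. -/
theorem SolvesDiag.duhamel (hψ : ContinuousOn ψ (Icc 0 T)) (hF : ContinuousOn F (Icc 0 T))
    (h : SolvesDiag b ω T F ψ) {t : ℝ} (ht : t ∈ Icc 0 T) :
    diagGroup b ω (-t) (ψ t) = ψ 0 + ∫ s in (0 : ℝ)..t, diagGroup b ω (-s) (F s) := by
  have hUF : ContinuousOn (fun s => diagGroup b ω (-s) (F s)) (Icc 0 T) :=
    continuousOn_diagGroup b ω continuous_neg hF
  refine repr_ext b fun n => ?_
  rw [← coordL_apply, ← coordL_apply, map_add, coordL_intervalIntegral hUF ht]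
  simp only [coordL_diagGroup]
  have hc := continuousOn_coordL b hψ n
  have hd : ∀ s ∈ Icc 0 T, HasDerivWithinAt (fun s => coordL b n (ψ s))
      (Complex.I * (ω n : ℂ) * coordL b n (ψ s) + coordL b n (F s)) (Icc 0 T) s := fun s hs =>
    hasDerivWithinAt_of_eq_integral
      ((continuousOn_const.mul hc).add (continuousOn_coordL b hF n)) (h n) hs
  -- The integrating factor `e^{-isω n}` cancels the diagonal term.
  have hz : ∀ s ∈ Icc 0 T, HasDerivWithinAt
      (fun s : ℝ => Complex.exp (Complex.I * ((-s * ω n : ℝ) : ℂ)) * coordL b n (ψ s))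
      (Complex.exp (Complex.I * ((-s * ω n : ℝ) : ℂ)) * coordL b n (F s)) (Icc 0 T) s := by
    intro s hs
    have h1 := hasDerivAt_cexp_I_mul (-ω n) s
    simp only [mul_neg, ← neg_mul] at h1
    refine (h1.hasDerivWithinAt.mul (hd s hs)).congr_deriv ?_
    push_cast
    ring
  have := eq_integral_of_hasDerivWithinAt (T := T) (g := fun s : ℝ =>
      Complex.exp (Complex.I * ((-s * ω n : ℝ) : ℂ)) * coordL b n (F s))
    ((by fun_prop : Continuous fun s : ℝ =>
      Complex.exp (Complex.I * ((-s * ω n : ℝ) : ℂ))).continuousOn.mul (continuousOn_coordL b hF n))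
    hz ht
  simpa using this

theorem exists_solvesDiag (b : HilbertBasis ι ℂ H) (ω : ι → ℝ) (hT : 0 ≤ T) (B : H →L[ℂ] H)
    (x₀ : H) : ∃ ψ : ℝ → H, ContinuousOn ψ (Icc 0 T) ∧ ψ 0 = x₀ ∧
      SolvesDiag b ω T (fun t => B (ψ t)) ψ := by
  -- Interaction picture: with `U` the diagonal group, `z = U(-t)ψ` solves `z' = U(-t) B U(t) z`,
  -- whose coefficient is bounded by `‖B‖`.
  obtain ⟨z, hz0, hz⟩ := exists_linear_ode_solution (M := ‖B‖) hT
    (A := fun t => ((diagGroup b ω (-t)).toContinuousLinearMap.comp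
      (B.comp (diagGroup b ω t).toContinuousLinearMap)).restrictScalars ℝ)
    (fun x => by
      have h : Continuous fun t => (-t, B (diagGroup b ω t x)) :=
        continuous_neg.prodMk (B.continuous.comp (continuous_diagGroup_apply b ω x))
      exact (continuous_diagGroup_uncurry b ω).comp
        (f := fun t => (-t, B (diagGroup b ω t x))) h)
    (fun t => by
      refine ContinuousLinearMap.opNorm_le_bound _ (norm_nonneg _) fun x => ?_
      change ‖diagGroup b ω (-t) (B (diagGroup b ω t x))‖ ≤ _
      rw [LinearIsometry.norm_map]
      exact (B.le_opNorm _).trans (by rw [LinearIsometry.norm_map])) x₀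
  have hzc : ContinuousOn z (Icc 0 T) := fun t ht => (hz t ht).continuousWithinAt
  have hψ := continuousOn_diagGroup b ω continuous_id hzc
  exact ⟨fun t => diagGroup b ω t (z t), hψ, (diagGroup_zero b ω _).trans hz0,
    solvesDiag_diagGroup (B.continuous.comp_continuousOn hψ) hz⟩

/-- Stability: distance between a solution of `ψ' = i ω ψ + B ψ` and an approximate solution with
residual `r`. -/
theorem SolvesDiag.norm_sub_le {B : H →L[ℂ] H} {w r : ℝ → H} {K ε : ℝ} (hB : ‖B‖ ≤ K)
    (hψ : ContinuousOn ψ (Icc 0 T)) (hψs : SolvesDiag b ω T (fun t => B (ψ t)) ψ)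
    (hw : ContinuousOn w (Icc 0 T)) (hr : ContinuousOn r (Icc 0 T))
    (hws : SolvesDiag b ω T (fun t => B (w t) + r t) w) (hε : ∀ t ∈ Icc 0 T, ‖r t‖ ≤ ε)
    {t : ℝ} (ht : t ∈ Icc 0 T) :
    ‖ψ t - w t‖ ≤ gronwallBound ‖ψ 0 - w 0‖ K ε t := by
  have hBψ : ContinuousOn (fun t => B (ψ t)) (Icc 0 T) := B.continuous.comp_continuousOn hψ
  have hBw : ContinuousOn (fun t => B (w t) + r t) (Icc 0 T) :=
    (B.continuous.comp_continuousOn hw).add hr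
  have hc1 := continuousOn_diagGroup b ω continuous_neg hBψ
  have hc2 := continuousOn_diagGroup b ω continuous_neg hBw
  -- After undoing the group, the difference has a strong derivative free of `ω`; the isometry then
  -- leaves only `B` and `r` in Gronwall's inequality.
  have hd : ∀ t ∈ Icc 0 T, HasDerivWithinAt (fun t => diagGroup b ω (-t) (ψ t - w t))
      (diagGroup b ω (-t) (B (ψ t - w t) - r t)) (Icc 0 T) t := by
    intro t ht
    have h1 := hasDerivWithinAt_of_eq_integral hc1 (fun s hs => hψs.duhamel hψ hBψ hs) ht
    have h2 := hasDerivWithinAt_of_eq_integral hc2 (fun s hs => hws.duhamel hw hBw hs) ht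
    have h := h1.sub h2
    simp only [map_sub, map_add] at h ⊢
    exact h.congr_deriv (by abel)
  have hb := norm_le_gronwallBound_of_norm_deriv_right_le
    (f := fun t => diagGroup b ω (-t) (ψ t - w t))
    (f' := fun t => diagGroup b ω (-t) (B (ψ t - w t) - r t))
    (δ := ‖ψ 0 - w 0‖) (K := K) (ε := ε) (a := 0) (b := T)
    (fun t ht => (hd t ht).continuousWithinAt)
    (fun t ht => (hd t ⟨ht.1, ht.2.le⟩).mono_of_mem_nhdsWithin (Icc_mem_nhdsGE_of_mem ht))
    (by rw [LinearIsometry.norm_map])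
    (fun t ht => by
      rw [LinearIsometry.norm_map, LinearIsometry.norm_map]
      refine (_root_.norm_sub_le _ _).trans (add_le_add ?_ (hε t ⟨ht.1, ht.2.le⟩))
      exact (B.le_opNorm _).trans (mul_le_mul_of_nonneg_right hB (norm_nonneg _)))
    t ht
  simpa only [sub_zero, LinearIsometry.norm_map] using hb

theorem SolvesDiag.unique {B : H →L[ℂ] H} {ψ' : ℝ → H}
    (hψ : ContinuousOn ψ (Icc 0 T)) (hψs : SolvesDiag b ω T (fun t => B (ψ t)) ψ)
    (hψ' : ContinuousOn ψ' (Icc 0 T)) (hψs' : SolvesDiag b ω T (fun t => B (ψ' t)) ψ')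
    (h0 : ψ 0 = ψ' 0) : EqOn ψ ψ' (Icc 0 T) := by
  intro t ht
  have h := hψs.norm_sub_le le_rfl hψ hψ' (r := fun _ => 0) continuousOn_const
    (by simpa using hψs') (ε := 0) (by simp) ht
  rw [h0, sub_self, norm_zero, gronwallBound_ε0_δ0] at h
  exact sub_eq_zero.1 (norm_le_zero_iff.1 h)

end Duhamel

/-! ### Derivatives and Fourier coefficients on the torus. -/

section TorusCalculus

variable {E : Type*} [NormedAddCommGroup E] [NormedSpace ℝ E]

/-- `f'` is the derivative of `f` on the torus. -/
def HasTorusDeriv (f f' : Torus → E) : Prop :=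
  ∀ x : ℝ, HasDerivAt (fun y : ℝ => f (y : Torus)) (f' (x : Torus)) x

theorem torusDeriv_coe (f : Torus → E) (x : ℝ) :
    torusDeriv f (x : Torus) = deriv (fun y : ℝ => f (y : Torus)) x := by
  have h := deriv_comp_const_add (fun y : ℝ => f (y : Torus)) x 0
  rw [add_zero] at h
  rw [← h, torusDeriv]
  simp only [AddCircle.coe_add]

theorem continuous_torus_iff {X : Type*} [TopologicalSpace X] {f : Torus → X} :
    Continuous f ↔ Continuous fun x : ℝ => f (x : Torus) :=
  (QuotientAddGroup.isOpenQuotientMap_mk (N := AddSubgroup.zmultiples (2 * Real.pi))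
    ).isQuotientMap.continuous_iff

theorem HasTorusDeriv.continuous {f f' : Torus → E} (h : HasTorusDeriv f f') : Continuous f :=
  continuous_torus_iff.2 (continuous_iff_continuousAt.2 fun x => (h x).continuousAt)

theorem TorusContDiff.continuous {n : WithTop ℕ∞} {f : Torus → E} (h : TorusContDiff n f) :
    Continuous f :=
  continuous_torus_iff.2 (ContDiff.continuous h)

theorem TorusContDiff.hasTorusDeriv {n : WithTop ℕ∞} (hn : n ≠ 0) {f : Torus → E}
    (h : TorusContDiff n f) : HasTorusDeriv f (torusDeriv f) := fun x => by
  rw [torusDeriv_coe]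
  exact ((ContDiff.differentiable h hn) x).hasDerivAt

theorem TorusContDiff.torusDeriv {n : WithTop ℕ∞} {f : Torus → E}
    (h : TorusContDiff (n + 1) f) : TorusContDiff n (torusDeriv f) := by
  have h1 := (contDiff_succ_iff_deriv.1 h).2.2
  rw [TorusContDiff]
  simpa only [torusDeriv_coe] using h1

theorem TorusContDiff.torusDeriv_top {f : Torus → E}
    (h : TorusContDiff (⊤ : ℕ∞) f) : TorusContDiff (⊤ : ℕ∞) (KdVSch.torusDeriv f) :=
  TorusContDiff.torusDeriv (n := ((⊤ : ℕ∞) : WithTop ℕ∞)) h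

theorem hasTorusDeriv_fourier (n : ℤ) :
    HasTorusDeriv (fourier (T := 2 * Real.pi) n) (fun x => Complex.I * n * fourier n x) := by
  intro x
  refine (hasDerivAt_fourier (2 * Real.pi) n x).congr_deriv ?_
  have : (Real.pi : ℂ) ≠ 0 := Complex.ofReal_ne_zero.2 Real.pi_ne_zero
  push_cast
  field_simp

theorem HasTorusDeriv.mul {f f' g g' : Torus → ℂ} (hf : HasTorusDeriv f f')
    (hg : HasTorusDeriv g g') :
    HasTorusDeriv (fun x => f x * g x) (fun x => f' x * g x + f x * g' x) :=
  fun x => (hf x).mul (hg x)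

theorem HasTorusDeriv.const_mul {f f' : Torus → ℂ} (c : ℂ) (hf : HasTorusDeriv f f') :
    HasTorusDeriv (fun x => c * f x) (fun x => c * f' x) :=
  fun x => (hf x).const_mul c

theorem HasTorusDeriv.congr {f f' g g' : Torus → E} (hf : HasTorusDeriv f f')
    (h : ∀ x, g x = f x) (h' : ∀ x, g' x = f' x) : HasTorusDeriv g g' := by
  rwa [funext h, funext h']

theorem HasTorusDeriv.integral_eq_zero [CompleteSpace E] {f f' : Torus → E}
    (hf : HasTorusDeriv f f') (hf' : Continuous f') : ∫ x, f' x ∂μT = 0 := by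
  rw [AddCircle.integral_haarAddCircle, ← AddCircle.intervalIntegral_preimage (2 * Real.pi) 0 f',
    intervalIntegral.integral_eq_sub_of_hasDerivAt (fun x _ => hf x)
      ((continuous_torus_iff.1 hf').intervalIntegrable _ _), zero_add, AddCircle.coe_period,
    AddCircle.coe_zero, sub_self, smul_zero]

/-- Integration by parts: the derivative of `e^{-inx} f` has zero mean. -/
theorem HasTorusDeriv.fourierCoeff_eq {f f' : Torus → ℂ} (hf : HasTorusDeriv f f')
    (hf' : Continuous f') (n : ℤ) :
    fourierCoeff f' n = Complex.I * n * fourierCoeff f n := by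
  have h := (hasTorusDeriv_fourier (-n)).mul hf
  have hc : Continuous fun x => Complex.I * ((-n : ℤ) : ℂ) * fourier (-n) x * f x :=
    (continuous_const.mul (fourier (-n)).continuous).mul hf.continuous
  have hc' : Continuous fun x => fourier (-n) x * f' x := (fourier (-n)).continuous.mul hf'
  have h0 := h.integral_eq_zero (hc.add hc')
  rw [integral_add (hc.integrable_of_hasCompactSupport (HasCompactSupport.of_compactSpace _))
    (hc'.integrable_of_hasCompactSupport (HasCompactSupport.of_compactSpace _))] at h0
  have e : ∫ x, Complex.I * ((-n : ℤ) : ℂ) * fourier (-n) x * f x ∂μT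
      = Complex.I * ((-n : ℤ) : ℂ) * fourierCoeff f n := by
    simp only [mul_assoc, integral_const_mul, fourierCoeff, smul_eq_mul]
  rw [e] at h0
  simp only [fourierCoeff, smul_eq_mul] at h0 ⊢
  rw [← sub_eq_zero, ← h0]
  push_cast
  ring

end TorusCalculus

/-! ### Multiplication operators and the bilinear pairing on `L²`. -/

section SquareIntegrable

/-- A continuous function as an element of `L²`. -/
abbrev contL2 : C(Torus, ℂ) →L[ℂ] L2T := ContinuousMap.toLp 2 μT ℂ

theorem contL2_ae (f : C(Torus, ℂ)) : contL2 f =ᵐ[μT] f := ContinuousMap.coeFn_toLp μT f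

/-- Multiplication by a continuous function on `L²`. -/
def mulL2 (V : C(Torus, ℂ)) : L2T →L[ℂ] L2T :=
  (ContinuousLinearMap.mul ℂ ℂ).holderL μT ⊤ 2 2 (ContinuousMap.toLp ⊤ μT ℂ V)

theorem mulL2_ae (V : C(Torus, ℂ)) (f : L2T) : mulL2 V f =ᵐ[μT] fun x => V x * f x := by
  have h := (ContinuousLinearMap.mul ℂ ℂ).coeFn_holder (r := 2)
    (ContinuousMap.toLp ⊤ μT ℂ V : Lp ℂ ⊤ μT) f
  filter_upwards [h, ContinuousMap.coeFn_toLp (p := ⊤) (𝕜 := ℂ) μT V] with x hx hV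
  rw [← hV]
  exact hx

theorem norm_mulL2_apply_le {V : C(Torus, ℂ)} {c : ℝ} (hV : ∀ x, ‖V x‖ ≤ c)
    (f : L2T) : ‖mulL2 V f‖ ≤ c * ‖f‖ := by
  refine Lp.norm_le_mul_norm_of_ae_le_mul ?_
  filter_upwards [mulL2_ae V f] with x hx
  rw [hx, norm_mul]
  exact mul_le_mul_of_nonneg_right (hV x) (norm_nonneg _)

theorem norm_mulL2_le {V : C(Torus, ℂ)} {c : ℝ} (hV : ∀ x, ‖V x‖ ≤ c) : ‖mulL2 V‖ ≤ c :=
  ContinuousLinearMap.opNorm_le_bound _ ((norm_nonneg _).trans (hV 0)) (norm_mulL2_apply_le hV)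

theorem norm_mulL2_of_norm_eq_one {V : C(Torus, ℂ)} (hV : ∀ x, ‖V x‖ = 1) (f : L2T) :
    ‖mulL2 V f‖ = ‖f‖ := by
  refine le_antisymm ?_ ?_ <;> refine Lp.norm_le_norm_of_ae_le ?_
  all_goals
    filter_upwards [mulL2_ae V f] with x hx
    rw [hx, norm_mul, hV, one_mul]

theorem mulL2_contL2 (V f : C(Torus, ℂ)) : mulL2 V (contL2 f) = contL2 (V * f) := by
  refine Lp.ext ?_
  filter_upwards [mulL2_ae V (contL2 f), contL2_ae f, contL2_ae (V * f)] with x h1 h2 h3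
  rw [h1, h2, h3, ContinuousMap.mul_apply]

theorem mulL2_mulL2 (V W : C(Torus, ℂ)) (f : L2T) : mulL2 V (mulL2 W f) = mulL2 (V * W) f := by
  refine Lp.ext ?_
  filter_upwards [mulL2_ae V (mulL2 W f), mulL2_ae W f, mulL2_ae (V * W) f] with x h1 h2 h3
  rw [h1, h2, h3, ContinuousMap.mul_apply, mul_assoc]

theorem mulL2_sub (V W : C(Torus, ℂ)) (f : L2T) : mulL2 (V - W) f = mulL2 V f - mulL2 W f := by
  refine Lp.ext ?_
  filter_upwards [mulL2_ae V f, mulL2_ae W f, mulL2_ae (V - W) f,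
    Lp.coeFn_sub (mulL2 V f) (mulL2 W f)] with x h1 h2 h3 h4
  rw [h3, h4, Pi.sub_apply, h1, h2, ContinuousMap.sub_apply, sub_mul]

/-- The measure has total mass one. -/
theorem norm_contL2_le {f : C(Torus, ℂ)} {c : ℝ} (hf : ∀ x, ‖f x‖ ≤ c) : ‖contL2 f‖ ≤ c := by
  have h := Lp.norm_le_of_ae_bound (f := contL2 f) ((norm_nonneg _).trans (hf 0))
    ((contL2_ae f).mono fun x hx => by rw [hx]; exact hf x)
  simpa [measureUnivNNReal] using h

/-- The bilinear pairing `∫ f g`. -/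
def pairL2 : L2T →L[ℂ] L2T →L[ℂ] ℂ := (ContinuousLinearMap.mul ℂ ℂ).lpPairing μT 2 2

theorem pairL2_contL2 (f : L2T) (g : C(Torus, ℂ)) :
    pairL2 f (contL2 g) = ∫ x, f x * g x ∂μT := by
  rw [pairL2, ContinuousLinearMap.lpPairing_eq_integral]
  refine integral_congr_ae ?_
  filter_upwards [contL2_ae g] with x hx
  rw [hx]; rfl

theorem coordL_fourierBasis (f : L2T) (n : ℤ) :
    coordL fourierBasis n f = fourierCoeff f n := by
  rw [coordL_apply, fourierBasis_repr]

theorem pairL2_fourier (f : L2T) (n : ℤ) :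
    pairL2 f (contL2 (fourier n)) = coordL fourierBasis (-n) f := by
  rw [pairL2_contL2, coordL_fourierBasis, fourierCoeff, neg_neg]
  simp only [smul_eq_mul, mul_comm]

/-- Parseval without conjugation, which is why mode `n` meets mode `-n`. -/
theorem hasSum_pairL2 (f g : L2T) :
    HasSum (fun n : ℤ => coordL fourierBasis n g * coordL fourierBasis (-n) f) (pairL2 f g) := by
  have h := (pairL2 f).hasSum (hasSum_fourier_series_L2 g)
  simp only [map_smul] at h
  refine h.congr_fun ?_
  intro n
  rw [coordL_fourierBasis, ← pairL2_fourier]; rfl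

theorem pairL2_mulL2 (V g : C(Torus, ℂ)) (f : L2T) :
    pairL2 (mulL2 V f) (contL2 g) = pairL2 f (contL2 (V * g)) := by
  rw [pairL2_contL2, pairL2_contL2]
  refine integral_congr_ae ?_
  filter_upwards [mulL2_ae V f] with x hx
  rw [hx, ContinuousMap.mul_apply]
  ring

theorem coordL_contL2 (f : C(Torus, ℂ)) (n : ℤ) :
    coordL fourierBasis n (contL2 f) = fourierCoeff f n := by
  rw [coordL_fourierBasis, fourierCoeff_toLp]

end SquareIntegrable

/-! ### Distributional solutions in Fourier coordinates, and well-posedness. -/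

section WeakSolutions

/-- The dispersion relation: `-∂ₓ³ + iα∂ₓ²` acts on the `n`-th mode as `i (n³ - α n²)`. -/
def dispersion (α : ℝ) (n : ℤ) : ℝ := (n : ℝ) ^ 3 - α * (n : ℝ) ^ 2

theorem fourierCoeff_third_order {f f₁ f₂ : Torus → ℂ} {f₃ a : C(Torus, ℂ)}
    (h₁ : HasTorusDeriv f f₁) (h₂ : HasTorusDeriv f₁ f₂) (h₃ : HasTorusDeriv f₂ f₃) {c d : ℂ}
    (ha : ∀ x, a x = c * f₃ x + d * f₂ x) (n : ℤ) :
    fourierCoeff a n = (c * (Complex.I * n) ^ 3 + d * (Complex.I * n) ^ 2) * fourierCoeff f n := by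
  have hi : ∀ g : C(Torus, ℂ), Integrable g μT := fun g =>
    g.continuous.integrable_of_hasCompactSupport (HasCompactSupport.of_compactSpace _)
  let F₂ : C(Torus, ℂ) := ⟨f₂, h₃.continuous⟩
  have e : fourierCoeff a n = c * fourierCoeff f₃ n + d * fourierCoeff F₂ n := by
    have : (a : Torus → ℂ) = (fun x => c * f₃ x) + (fun x => d * F₂ x) := funext ha
    rw [this, fourierCoeff.add ((hi f₃).const_mul c) ((hi F₂).const_mul d)]
    rw [Pi.add_apply, fourierCoeff.const_mul, fourierCoeff.const_mul]
  rw [e, h₃.fourierCoeff_eq f₃.continuous]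
  change c * (_ * fourierCoeff f₂ n) + d * fourierCoeff f₂ n = _
  rw [h₂.fourierCoeff_eq h₃.continuous, h₁.fourierCoeff_eq h₂.continuous]
  ring

theorem dispersion_neg_symbol (α : ℝ) (n : ℤ) :
    (-1) * (Complex.I * n) ^ 3 + Complex.I * α * (Complex.I * n) ^ 2
      = Complex.I * (dispersion α n : ℂ) := by
  have h3 : Complex.I ^ 3 = -Complex.I := Complex.I_pow_three
  rw [mul_pow, mul_pow, h3, Complex.I_sq, dispersion]
  push_cast
  ring

/-- Transposition changes the sign of `∂ₓ`, hence of the frequency. -/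
theorem dispersion_transpose_symbol (α : ℝ) (n : ℤ) :
    1 * (Complex.I * n) ^ 3 + Complex.I * α * (Complex.I * n) ^ 2
      = Complex.I * (dispersion α (-n) : ℂ) := by
  have h3 : Complex.I ^ 3 = -Complex.I := Complex.I_pow_three
  rw [mul_pow, mul_pow, h3, Complex.I_sq, dispersion]
  push_cast
  ring

/-- The transpose `θ''' + iα θ''` of the differential operator, on smooth functions. -/
theorem exists_transpose {α : ℝ} {θ : Torus → ℂ} (hθ : TorusContDiff (⊤ : ℕ∞) θ) :
    ∃ a : C(Torus, ℂ), (∀ x, a x = torusDeriv (torusDeriv (torusDeriv θ)) x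
      + Complex.I * (α : ℂ) * torusDeriv (torusDeriv θ) x) ∧
      ∀ n, fourierCoeff a n = Complex.I * (dispersion α (-n) : ℂ) * fourierCoeff θ n := by
  have h1 := hθ.torusDeriv_top
  have h2 := h1.torusDeriv_top
  have h3 := h2.torusDeriv_top
  refine ⟨⟨_, h3.continuous.add (continuous_const.mul h2.continuous)⟩, fun x => rfl, fun n => ?_⟩
  rw [← dispersion_transpose_symbol]
  exact fourierCoeff_third_order (f₃ := ⟨_, h3.continuous⟩) (hθ.hasTorusDeriv (by simp))
    (h1.hasTorusDeriv (by simp)) (h2.hasTorusDeriv (by simp))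
    (fun x => by rw [one_mul]; rfl) n

theorem torusContDiff_fourier (n : ℤ) :
    TorusContDiff (⊤ : ℕ∞) (fourier (T := 2 * Real.pi) n) := by
  rw [TorusContDiff]
  have : (fun x : ℝ => fourier (T := 2 * Real.pi) n (x : Torus))
      = fun x : ℝ => Complex.exp (2 * Real.pi * Complex.I * n * x / (2 * Real.pi : ℝ)) := by
    funext x; exact fourier_coe_apply
  rw [this]
  refine Complex.contDiff_exp.comp ?_ |>.of_le le_top
  exact (contDiff_const.mul Complex.ofRealCLM.contDiff).div_const _

variable {q : ℕ} {α T : ℝ} {Q : Fin q → Torus → ℝ} {v : Fin q → ℝ} {ψ₀ : L2T} {ψ : ℝ → L2T}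

theorem pairL2_weak_identity {P : C(Torus, ℂ)}
    (hψ : ContinuousOn ψ (Icc 0 T)) {t : ℝ} (ht : t ∈ Icc 0 T) (f a : L2T) :
    ∫ s in (0 : ℝ)..t, (pairL2 (ψ s) a + pairL2 (mulL2 P (ψ s)) f)
      = pairL2 (∫ s in (0 : ℝ)..t, ψ s) a + pairL2 (∫ s in (0 : ℝ)..t, mulL2 P (ψ s)) f := by
  have hsub : uIcc 0 t ⊆ Icc 0 T := uIcc_subset_Icc ⟨le_rfl, ht.1.trans ht.2⟩ ht
  have h1 : IntervalIntegrable ψ volume 0 t := (hψ.mono hsub).intervalIntegrable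
  have h2 : IntervalIntegrable (fun s => mulL2 P (ψ s)) volume 0 t :=
    ((mulL2 P).continuous.comp_continuousOn (hψ.mono hsub)).intervalIntegrable
  have e1 := (pairL2.flip a).intervalIntegral_comp_comm h1
  have e2 := (pairL2.flip f).intervalIntegral_comp_comm h2
  simp only [ContinuousLinearMap.flip_apply] at e1 e2
  rw [← e1, ← e2]
  refine intervalIntegral.integral_add ?_ ?_
  · exact ((pairL2.flip a).continuous.comp_continuousOn (hψ.mono hsub)).intervalIntegrable
  · exact ((pairL2.flip f).continuous.comp_continuousOn
      ((mulL2 P).continuous.comp_continuousOn (hψ.mono hsub))).intervalIntegrable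

theorem weak_integrand {P θ a : C(Torus, ℂ)} (hP : ∀ x, P x = Complex.I * (dotQ Q v x : ℂ))
    (ha : ∀ x, a x = torusDeriv (torusDeriv (torusDeriv θ)) x
      + Complex.I * (α : ℂ) * torusDeriv (torusDeriv θ) x) (f : L2T) :
    ∫ x, f x * (torusDeriv (torusDeriv (torusDeriv θ)) x
          + Complex.I * (α : ℂ) * torusDeriv (torusDeriv θ) x
          + Complex.I * (dotQ Q v x : ℂ) * θ x) ∂μT
      = pairL2 f (contL2 a) + pairL2 (mulL2 P f) (contL2 θ) := by
  rw [pairL2_mulL2, ← map_add, ← map_add, pairL2_contL2]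
  refine integral_congr_ae (ae_of_all _ fun x => ?_)
  simp only [ContinuousMap.add_apply, ContinuousMap.mul_apply, ha, hP]

/-- A distributional solution is a solution in Fourier coordinates. -/
theorem isSolution_iff_solvesDiag {P : C(Torus, ℂ)}
    (hP : ∀ x, P x = Complex.I * (dotQ Q v x : ℂ)) :
    IsSolution α Q (fun _ => v) T ψ₀ ψ ↔ ContinuousOn ψ (Icc 0 T) ∧ ψ 0 = ψ₀ ∧
      SolvesDiag fourierBasis (dispersion α) T (fun t => mulL2 P (ψ t)) ψ := by
  constructor
  · rintro ⟨hc, h0, hw⟩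
    refine ⟨hc, h0, fun n t ht => ?_⟩
    obtain ⟨a, ha, hca⟩ := exists_transpose (α := α) (torusContDiff_fourier (-n))
    -- The test function `e^{-inx}` is an eigenfunction of the transpose, so testing with it gives
    -- exactly the equation of the `n`-th coordinate.
    have haθ : contL2 a = (Complex.I * (dispersion α n : ℂ)) • contL2 (fourier (-n)) := by
      refine repr_ext fourierBasis fun m => ?_
      rw [← coordL_apply, ← coordL_apply, map_smul, coordL_contL2, coordL_contL2, hca,
        fourierCoeff_fourier, smul_eq_mul]
      rcases eq_or_ne m (-n) with rfl | hm
      · rw [neg_neg]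
      · rw [Pi.single_eq_of_ne hm, mul_zero, mul_zero]
    have h := hw _ (torusContDiff_fourier (-n)) t ht
    simp only [weak_integrand hP ha] at h
    rw [← pairL2_contL2, ← pairL2_contL2, haθ, ← h0] at h
    simp only [map_smul, smul_eq_mul, pairL2_fourier, neg_neg] at h
    exact h
  · rintro ⟨hc, h0, hs⟩
    refine ⟨hc, h0, fun θ hθ t ht => ?_⟩
    obtain ⟨a, ha, hca⟩ := exists_transpose (α := α) hθ
    let Θ : C(Torus, ℂ) := ⟨θ, hθ.continuous⟩
    have e := fun f => weak_integrand (θ := Θ) hP ha f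
    simp only [Θ, ContinuousMap.coe_mk] at e
    simp only [e]
    rw [pairL2_weak_identity hc ht]
    change ∫ x, ψ t x * Θ x ∂μT = ∫ x, ψ₀ x * Θ x ∂μT + _
    rw [← pairL2_contL2, ← pairL2_contL2, ← h0, add_comm (pairL2 _ (contL2 a)), ← add_assoc,
      ← sub_eq_iff_eq_add']
    have hBc : ContinuousOn (fun s => mulL2 P (ψ s)) (Icc 0 T) :=
      (mulL2 P).continuous.comp_continuousOn hc
    set J := ∫ s in (0 : ℝ)..t, ψ s
    set K := ∫ s in (0 : ℝ)..t, mulL2 P (ψ s)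
    -- Integrating in time first leaves the symbol acting on the single vector `J`. Two Parseval
    -- sums, one with the symbol on `J` and one with it on `θ`, then agree term by term, with no
    -- interchange of sum and time integral.
    have hcoord : ∀ n, coordL fourierBasis n (ψ t - (ψ 0 + K))
        = Complex.I * (dispersion α n : ℂ) * coordL fourierBasis n J := by
      intro n
      have hsub : uIcc 0 t ⊆ Icc 0 T := uIcc_subset_Icc ⟨le_rfl, ht.1.trans ht.2⟩ ht
      have h := hs n t ht
      have hi : IntervalIntegrable
          (fun s => Complex.I * (dispersion α n : ℂ) * coordL fourierBasis n (ψ s)) volume 0 t :=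
        ((continuousOn_const.mul (continuousOn_coordL fourierBasis hc n)).mono
          hsub).intervalIntegrable
      rw [intervalIntegral.integral_add hi
        ((continuousOn_coordL fourierBasis hBc n).mono hsub).intervalIntegrable,
        intervalIntegral.integral_const_mul] at h
      have eJ : coordL fourierBasis n J = ∫ s in (0 : ℝ)..t, coordL fourierBasis n (ψ s) :=
        coordL_intervalIntegral hc ht n
      have eK : coordL fourierBasis n K
          = ∫ s in (0 : ℝ)..t, coordL fourierBasis n (mulL2 P (ψ s)) :=
        coordL_intervalIntegral hBc ht n
      rw [map_sub, map_add, h, eJ, eK]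
      ring
    have h1 := hasSum_pairL2 (ψ t - (ψ 0 + K)) (contL2 Θ)
    have h2 := hasSum_pairL2 J (contL2 a)
    have h3 := h1.unique (h2.congr_fun ?_)
    · rw [← h3]
      simp only [map_sub, map_add, sub_apply, add_apply]
      rfl
    · intro n
      rw [hcoord, coordL_contL2, coordL_contL2, hca]
      change fourierCoeff θ n * _ = _
      ring

theorem wellPosed_of_nonneg (hT : 0 ≤ T) {P : C(Torus, ℂ)}
    (hP : ∀ x, P x = Complex.I * (dotQ Q v x : ℂ)) (ψ₀ : L2T) :
    WellPosed α Q (fun _ => v) T ψ₀ := by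
  obtain ⟨ψ, hc, h0, hs⟩ := exists_solvesDiag fourierBasis (dispersion α) hT (mulL2 P) ψ₀
  refine ⟨ψ, (isSolution_iff_solvesDiag hP).2 ⟨hc, h0, hs⟩, fun ψ' hψ' => ?_⟩
  obtain ⟨hc', h0', hs'⟩ := (isSolution_iff_solvesDiag hP).1 hψ'
  exact hs'.unique hc' hc hs (h0'.trans h0.symm)

end WeakSolutions

/-! ### Three derivatives of an oscillating product. -/

section ThreeDerivatives

/-- `f₁, f₂, f₃` are the first three derivatives of `f`, the last one being continuous. -/
structure HasThreeDerivs {E : Type*} [NormedAddCommGroup E] [NormedSpace ℝ E]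
    (f f₁ f₂ f₃ : Torus → E) : Prop where
  first : HasTorusDeriv f f₁
  second : HasTorusDeriv f₁ f₂
  third : HasTorusDeriv f₂ f₃
  continuous_third : Continuous f₃

theorem TorusContDiff.hasThreeDerivs {E : Type*} [NormedAddCommGroup E] [NormedSpace ℝ E]
    {f : Torus → E} (h : TorusContDiff 3 f) :
    HasThreeDerivs f (KdVSch.torusDeriv f) (KdVSch.torusDeriv (KdVSch.torusDeriv f))
      (KdVSch.torusDeriv (KdVSch.torusDeriv (KdVSch.torusDeriv f))) := by
  have h1 : TorusContDiff 2 (KdVSch.torusDeriv f) :=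
    TorusContDiff.torusDeriv (n := 2) (by rwa [show (2 : WithTop ℕ∞) + 1 = 3 by norm_num])
  have h2 : TorusContDiff 1 (KdVSch.torusDeriv (KdVSch.torusDeriv f)) :=
    TorusContDiff.torusDeriv (n := 1) (by rwa [show (1 : WithTop ℕ∞) + 1 = 2 by norm_num])
  have h3 : TorusContDiff 0 (KdVSch.torusDeriv (KdVSch.torusDeriv (KdVSch.torusDeriv f))) :=
    TorusContDiff.torusDeriv (n := 0) (by rwa [zero_add])
  exact ⟨h.hasTorusDeriv (by norm_num), h1.hasTorusDeriv (by norm_num),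
    h2.hasTorusDeriv (by norm_num), h3.continuous⟩

/-- The oscillating exponential `e^{iθ}`. -/
def cis (θ : Torus → ℝ) (x : Torus) : ℂ := Complex.exp (Complex.I * (θ x : ℂ))

theorem norm_cis (θ : Torus → ℝ) (x : Torus) : ‖cis θ x‖ = 1 := norm_cexp_I_mul_ofReal _

theorem HasTorusDeriv.cis {θ θ' : Torus → ℝ} (h : HasTorusDeriv θ θ') :
    HasTorusDeriv (cis θ) (fun x => cis θ x * (Complex.I * (θ' x : ℂ))) :=
  fun x => ((h x).ofReal_comp.const_mul Complex.I).cexp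

theorem HasTorusDeriv.ofReal {θ θ' : Torus → ℝ} (h : HasTorusDeriv θ θ') :
    HasTorusDeriv (fun x => (θ x : ℂ)) (fun x => (θ' x : ℂ)) :=
  fun x => (h x).ofReal_comp

theorem HasTorusDeriv.add {f f' g g' : Torus → ℂ} (hf : HasTorusDeriv f f')
    (hg : HasTorusDeriv g g') : HasTorusDeriv (fun x => f x + g x) (fun x => f' x + g' x) :=
  fun x => (hf x).add (hg x)

theorem HasThreeDerivs.linear_comb {f f₁ f₂ f₃ g g₁ g₂ g₃ : Torus → ℝ}
    (hf : HasThreeDerivs f f₁ f₂ f₃) (hg : HasThreeDerivs g g₁ g₂ g₃) (a b : ℝ) :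
    HasThreeDerivs (fun x => a * f x + b * g x) (fun x => a * f₁ x + b * g₁ x)
      (fun x => a * f₂ x + b * g₂ x) (fun x => a * f₃ x + b * g₃ x) :=
  ⟨fun x => ((hf.first x).const_mul a).add ((hg.first x).const_mul b),
    fun x => ((hf.second x).const_mul a).add ((hg.second x).const_mul b),
    fun x => ((hf.third x).const_mul a).add ((hg.third x).const_mul b),
    (continuous_const.mul hf.continuous_third).add (continuous_const.mul hg.continuous_third)⟩

/-- The first three derivatives of `e^{iθ} f`. -/
theorem HasThreeDerivs.cis_mul {θ θ₁ θ₂ θ₃ : Torus → ℝ} {f f₁ f₂ f₃ : Torus → ℂ}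
    (hθ : HasThreeDerivs θ θ₁ θ₂ θ₃) (hf : HasThreeDerivs f f₁ f₂ f₃) :
    HasThreeDerivs (fun x => cis θ x * f x)
      (fun x => cis θ x * (Complex.I * θ₁ x * f x + f₁ x))
      (fun x => cis θ x * ((Complex.I * θ₁ x) ^ 2 * f x + Complex.I * θ₂ x * f x
        + 2 * (Complex.I * θ₁ x) * f₁ x + f₂ x))
      (fun x => cis θ x * ((Complex.I * θ₁ x) ^ 3 * f x
        + 3 * (Complex.I * θ₁ x) * (Complex.I * θ₂ x) * f x + Complex.I * θ₃ x * f x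
        + 3 * ((Complex.I * θ₁ x) ^ 2 + Complex.I * θ₂ x) * f₁ x
        + 3 * (Complex.I * θ₁ x) * f₂ x + f₃ x)) := by
  have he := hθ.first.cis
  have h1 := hθ.second.ofReal.const_mul Complex.I
  have h2 := hθ.third.ofReal.const_mul Complex.I
  refine ⟨?_, ?_, ?_, ?_⟩
  · refine (he.mul hf.first).congr (fun x => rfl) (fun x => ?_)
    ring
  · refine (he.mul ((h1.mul hf.first).add hf.second)).congr (fun x => rfl) (fun x => ?_)
    ring
  · refine (he.mul (((((h1.mul h1).mul hf.first).add (h2.mul hf.first)).add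
      ((h1.mul hf.second).const_mul 2)).add hf.third)).congr (fun x => ?_) (fun x => ?_)
    · ring
    · ring
  · have c0 := he.continuous
    have c1 := h1.continuous
    have c2 := h2.continuous
    have c3 : Continuous fun x => Complex.I * (θ₃ x : ℂ) :=
      continuous_const.mul (Complex.continuous_ofReal.comp hθ.continuous_third)
    have d0 := hf.first.continuous
    have d1 := hf.second.continuous
    have d2 := hf.third.continuous
    have d3 := hf.continuous_third
    fun_prop

end ThreeDerivatives

/-! ### Classical functions as approximate solutions. -/

section ApproximateSolutions

/-- Point evaluations are continuous functionals separating `C(Torus, ℂ)`, so the scalar fundamental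
theorem at each point gives the vector-valued identity. -/
theorem eq_add_integral_of_pointwise {w w' : ℝ → C(Torus, ℂ)} (hw' : Continuous w')
    (hd : ∀ t x, HasDerivAt (fun s => w s x) (w' t x) t) (t : ℝ) :
    w t = w 0 + ∫ s in (0 : ℝ)..t, w' s := by
  ext x
  have h := (ContinuousMap.evalCLM ℂ x).intervalIntegral_comp_comm
    (hw'.intervalIntegrable (μ := volume) 0 t)
  simp only [ContinuousMap.evalCLM_apply] at h
  rw [ContinuousMap.add_apply, ← h,
    intervalIntegral.integral_eq_sub_of_hasDerivAt (fun s _ => hd s x)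
      (((ContinuousMap.evalCLM ℂ x).continuous.comp hw').intervalIntegrable _ _)]
  ring

/-- A function with classical derivatives satisfies the equation in Fourier coordinates, up to its
residual. -/
theorem solvesDiag_of_classical {α T : ℝ} {P : C(Torus, ℂ)} {w w' r : ℝ → C(Torus, ℂ)}
    (hw' : Continuous w')
    (hd : ∀ t x, HasDerivAt (fun s => w s x) (w' t x) t) {w₁ w₂ w₃ : ℝ → Torus → ℂ}
    (h3 : ∀ t, HasThreeDerivs (w t) (w₁ t) (w₂ t) (w₃ t))
    (heq : ∀ t x, w' t x = -w₃ t x + Complex.I * α * w₂ t x + P x * w t x + r t x) :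
    SolvesDiag fourierBasis (dispersion α) T (fun t => mulL2 P (contL2 (w t)) + contL2 (r t))
      (fun t => contL2 (w t)) := by
  intro n t _
  have hL : ∀ s, Complex.I * (dispersion α n : ℂ) * coordL fourierBasis n (contL2 (w s))
      + coordL fourierBasis n (mulL2 P (contL2 (w s)) + contL2 (r s))
      = coordL fourierBasis n (contL2 (w' s)) := by
    intro s
    let a : C(Torus, ℂ) := ⟨fun x => (-1) * w₃ s x + Complex.I * α * w₂ s x,
      (continuous_const.mul (h3 s).continuous_third).add
        (continuous_const.mul (h3 s).third.continuous)⟩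
    have ha := fourierCoeff_third_order (f₃ := ⟨w₃ s, (h3 s).continuous_third⟩) (a := a)
      (h3 s).first (h3 s).second (h3 s).third (c := -1) (d := Complex.I * α) (fun x => rfl) n
    rw [dispersion_neg_symbol, ← coordL_contL2, ← coordL_contL2] at ha
    have e : w' s = a + P * w s + r s := by
      ext x
      rw [heq]
      simp only [ContinuousMap.add_apply, ContinuousMap.mul_apply, a, ContinuousMap.coe_mk]
      ring
    rw [e, ← ha, mulL2_contL2, map_add contL2, map_add contL2, map_add, map_add, map_add]
    ring
  simp only [hL]
  have h := congrArg (fun g => coordL fourierBasis n (contL2 g))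
    (eq_add_integral_of_pointwise hw' hd t)
  have hint := ((coordL (fourierBasis (T := 2 * Real.pi)) n).comp contL2
    ).intervalIntegral_comp_comm (hw'.intervalIntegrable (μ := volume) 0 t)
  simp only [ContinuousLinearMap.comp_apply] at hint
  rw [hint]
  simpa only [map_add] using h

end ApproximateSolutions

/-! ### The oscillating ansatz and its residual. -/

section OscillatingSolutions

/-- The lower order terms of the conjugated equation, where `a`, `b`, `c` are `κ` times the
derivatives of the phase and `p` is the derivative of the leading part of the phase. -/
def phaseRemainder (α κ s p G₁ a b c : ℝ) (f f₁ f₂ f₃ : ℂ) : ℂ :=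
  -Complex.I * s * G₁ * (a ^ 2 - a * p + p ^ 2) * f - 3 * a * b * f + Complex.I * κ * c * f
    + 3 * (-a ^ 2 + Complex.I * κ * b) * f₁ + 3 * Complex.I * κ * a * f₂ + κ ^ 2 * f₃
    - Complex.I * α * (-a ^ 2 * f + Complex.I * κ * b * f + 2 * Complex.I * κ * a * f₁
      + κ ^ 2 * f₂)

/-- With `a = κ t₁ = -p + κ s G₁`, the cubic term leaves `a³ + p³ = (a + p)(a² - a p + p²)`, and `a
+ p = κ s G₁` supplies the factor `κ`. Every other term carries a spare `κ` once `κ` is absorbed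
into each `tⱼ`. -/
theorem conjugated_operator_expansion {κ : ℝ} (hκ : κ ≠ 0)
    (α s p p₂ p₃ G₁ G₂ G₃ : ℝ) (g f f₁ f₂ f₃ : ℂ) {t₁ t₂ t₃ : ℂ}
    (h₁ : t₁ = ((-κ⁻¹ * p + s * G₁ : ℝ) : ℂ)) (h₂ : t₂ = ((-κ⁻¹ * p₂ + s * G₂ : ℝ) : ℂ))
    (h₃ : t₃ = ((-κ⁻¹ * p₃ + s * G₃ : ℝ) : ℂ)) :
    Complex.I * g * f + κ ^ 3 * ((Complex.I * t₁) ^ 3 * f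
        + 3 * (Complex.I * t₁) * (Complex.I * t₂) * f + Complex.I * t₃ * f
        + 3 * ((Complex.I * t₁) ^ 2 + Complex.I * t₂) * f₁
        + 3 * (Complex.I * t₁) * f₂ + f₃)
      - Complex.I * α * κ ^ 3 * ((Complex.I * t₁) ^ 2 * f + Complex.I * t₂ * f
        + 2 * (Complex.I * t₁) * f₁ + f₂)
    = Complex.I * (g + p ^ 3) * f + κ * phaseRemainder α κ s p G₁ (-p + κ * s * G₁)
      (-p₂ + κ * s * G₂) (-p₃ + κ * s * G₃) f f₁ f₂ f₃ := by
  have hκ' : (κ : ℂ) ≠ 0 := Complex.ofReal_ne_zero.2 hκ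
  have e₁ : (κ : ℂ) * t₁ = -p + κ * s * G₁ := by
    rw [h₁]; push_cast; field_simp
  have e₂ : (κ : ℂ) * t₂ = -p₂ + κ * s * G₂ := by
    rw [h₂]; push_cast; field_simp
  have e₃ : (κ : ℂ) * t₃ = -p₃ + κ * s * G₃ := by
    rw [h₃]; push_cast; field_simp
  rw [phaseRemainder]
  push_cast
  rw [← e₁, ← e₂, ← e₃]
  have e₄ : (κ : ℂ) * s * G₁ = κ * t₁ + p := by rw [e₁]; ring
  have hI : Complex.I ^ 2 = -1 := Complex.I_sq
  have hI3 : Complex.I ^ 3 = -Complex.I := Complex.I_pow_three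
  linear_combination (Complex.I * ((κ * t₁) ^ 2 - κ * t₁ * p + p ^ 2) * f) * e₄
    + (κ ^ 3 * t₁ ^ 3 * f) * hI3
    + (3 * κ ^ 3 * t₁ * t₂ * f + 3 * κ ^ 3 * t₁ ^ 2 * f₁ - Complex.I * α * κ ^ 3 * t₁ ^ 2 * f) * hI

variable {φ φ₁ φ₂ φ₃ G G₁ G₂ G₃ V : Torus → ℝ} {f f₁ f₂ f₃ : Torus → ℂ}

/-- No negative power of `κ` is left in the remainder, so it is continuous up to `κ = 0` and bounded
by compactness. -/
theorem exists_phaseRemainder_bound (α : ℝ) (hφ : HasThreeDerivs φ φ₁ φ₂ φ₃)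
    (hG : HasThreeDerivs G G₁ G₂ G₃) (hf : HasThreeDerivs f f₁ f₂ f₃) :
    ∃ C : ℝ, ∀ κ ∈ Icc (0 : ℝ) 1, ∀ s ∈ Icc (0 : ℝ) 1, ∀ x,
      ‖phaseRemainder α κ s (φ₁ x) (G₁ x) (-φ₁ x + κ * s * G₁ x) (-φ₂ x + κ * s * G₂ x)
        (-φ₃ x + κ * s * G₃ x) (f x) (f₁ x) (f₂ x) (f₃ x)‖ ≤ C := by
  have hc : Continuous fun p : ℝ × ℝ × Torus =>
      phaseRemainder α p.1 p.2.1 (φ₁ p.2.2) (G₁ p.2.2) (-φ₁ p.2.2 + p.1 * p.2.1 * G₁ p.2.2)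
        (-φ₂ p.2.2 + p.1 * p.2.1 * G₂ p.2.2) (-φ₃ p.2.2 + p.1 * p.2.1 * G₃ p.2.2)
        (f p.2.2) (f₁ p.2.2) (f₂ p.2.2) (f₃ p.2.2) := by
    have := hφ.second.continuous
    have := hφ.third.continuous
    have := hφ.continuous_third
    have := hG.second.continuous
    have := hG.third.continuous
    have := hG.continuous_third
    have := hf.first.continuous
    have := hf.second.continuous
    have := hf.third.continuous
    have := hf.continuous_third
    unfold phaseRemainder
    fun_prop
  obtain ⟨C, hC⟩ := ((isCompact_Icc (a := (0 : ℝ)) (b := 1)).prod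
    ((isCompact_Icc (a := (0 : ℝ)) (b := 1)).prod (isCompact_univ (X := Torus)))
    ).exists_bound_of_continuousOn hc.continuousOn
  exact ⟨C, fun κ hκ s hs x => hC (κ, s, x) ⟨hκ, hs, mem_univ x⟩⟩

theorem hasDerivAt_cis_time (φ G : Torus → ℝ) (a c : ℝ) (t : ℝ) (x : Torus) :
    HasDerivAt (fun s : ℝ => cis (fun x => a * φ x + c * s * G x) x)
      (Complex.I * c * G x * cis (fun x => a * φ x + c * t * G x) x) t := by
  have h : HasDerivAt (fun s : ℝ => a * φ x + c * s * G x) (c * 1 * G x) t :=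
    (((hasDerivAt_id t).const_mul c).mul_const (G x)).const_add _
  refine ((h.ofReal_comp.const_mul Complex.I).cexp).congr_deriv ?_
  simp only [cis]
  push_cast
  ring

/-- Distance from an exact solution on `[0, κ³]` to the oscillating approximate solution
`exp (i (-φ / κ + t G / κ³)) f`. -/
theorem exists_oscillating_estimate (α : ℝ) (hφ : HasThreeDerivs φ φ₁ φ₂ φ₃)
    (hG : HasThreeDerivs G G₁ G₂ G₃) (hf : HasThreeDerivs f f₁ f₂ f₃) (hV : Continuous V) {M η : ℝ}
    (hM : ∀ x, |V x| ≤ M) (hη : ∀ x, ‖((G x - V x + φ₁ x ^ 3 : ℝ) : ℂ) * f x‖ ≤ η) :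
    ∃ C : ℝ, ∀ κ ∈ Ioc (0 : ℝ) 1, ∀ P e₀ e₁ : C(Torus, ℂ),
      (∀ x, P x = Complex.I * (((κ ^ 3)⁻¹ * V x : ℝ) : ℂ)) →
      (∀ x, e₀ x = cis (fun x => -κ⁻¹ * φ x) x * f x) →
      (∀ x, e₁ x = cis (fun x => -κ⁻¹ * φ x + G x) x * f x) →
      ∀ ψ : ℝ → L2T, ContinuousOn ψ (Icc 0 (κ ^ 3)) →
        SolvesDiag fourierBasis (dispersion α) (κ ^ 3) (fun t => mulL2 P (ψ t)) ψ →
        ‖ψ (κ ^ 3) - contL2 e₁‖ ≤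
          gronwallBound ‖ψ 0 - contL2 e₀‖ (M / κ ^ 3) ((η + κ * C) / κ ^ 3) (κ ^ 3) := by
  obtain ⟨C, hC⟩ := exists_phaseRemainder_bound α hφ hG hf
  refine ⟨C, fun κ hκ P e₀ e₁ hP he₀ he₁ ψ hψ hψs => ?_⟩
  have hκ0 : 0 < κ := hκ.1
  have hτ : 0 < κ ^ 3 := pow_pos hκ0 3
  have cφ := hφ.first.continuous
  have cφ₁ := hφ.second.continuous
  have cφ₂ := hφ.third.continuous
  have cφ₃ := hφ.continuous_third
  have cG := hG.first.continuous
  have cG₁ := hG.second.continuous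
  have cG₂ := hG.third.continuous
  have cG₃ := hG.continuous_third
  have cf := hf.first.continuous
  have cf₁ := hf.second.continuous
  have cf₂ := hf.third.continuous
  have cf₃ := hf.continuous_third
  -- Currying turns joint continuity in time and space into continuity in time for the sup norm.
  let w : C(ℝ, C(Torus, ℂ)) := ContinuousMap.curry
    ⟨fun p => cis (fun x => -κ⁻¹ * φ x + (κ ^ 3)⁻¹ * p.1 * G x) p.2 * f p.2, by
      unfold cis; fun_prop⟩
  let w' : C(ℝ, C(Torus, ℂ)) := ContinuousMap.curry
    ⟨fun p => Complex.I * ((κ ^ 3)⁻¹ : ℝ) * G p.2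
      * cis (fun x => -κ⁻¹ * φ x + (κ ^ 3)⁻¹ * p.1 * G x) p.2 * f p.2, by
      unfold cis; fun_prop⟩
  have hw3 := fun t : ℝ => (hφ.linear_comb hG (-κ⁻¹) ((κ ^ 3)⁻¹ * t)).cis_mul hf
  have hwd : ∀ t x, HasDerivAt (fun s => w s x) (w' t x) t := fun t x =>
    (hasDerivAt_cis_time φ G (-κ⁻¹) ((κ ^ 3)⁻¹) t x).mul_const (f x)
  let r : C(ℝ, C(Torus, ℂ)) := ContinuousMap.curry
    ⟨fun p => ((κ ^ 3)⁻¹ : ℝ) * (cis (fun x => -κ⁻¹ * φ x + (κ ^ 3)⁻¹ * p.1 * G x) p.2 *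
      (Complex.I * (((G p.2 : ℂ) - V p.2) + φ₁ p.2 ^ 3) * f p.2 + κ *
        phaseRemainder α κ ((κ ^ 3)⁻¹ * p.1) (φ₁ p.2) (G₁ p.2)
          (-φ₁ p.2 + κ * ((κ ^ 3)⁻¹ * p.1) * G₁ p.2) (-φ₂ p.2 + κ * ((κ ^ 3)⁻¹ * p.1) * G₂ p.2)
          (-φ₃ p.2 + κ * ((κ ^ 3)⁻¹ * p.1) * G₃ p.2) (f p.2) (f₁ p.2) (f₂ p.2) (f₃ p.2))), by
      unfold cis phaseRemainder; fun_prop⟩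
  have hs := solvesDiag_of_classical (α := α) (T := κ ^ 3) (P := P) (w := w) (w' := w') (r := r)
    w'.continuous hwd hw3 (fun t x => by
      have hx := conjugated_operator_expansion hκ0.ne' α ((κ ^ 3)⁻¹ * t) (φ₁ x) (φ₂ x) (φ₃ x)
        (G₁ x) (G₂ x) (G₃ x) ((G x : ℂ) - V x) (f x) (f₁ x) (f₂ x) (f₃ x) rfl rfl rfl
      simp only [w, w', r, ContinuousMap.curry_apply, ContinuousMap.coe_mk, hP]
      rw [← hx]
      have : (κ : ℂ) ≠ 0 := Complex.ofReal_ne_zero.2 hκ0.ne'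
      push_cast
      field_simp
      ring)
  have hr : ∀ t ∈ Icc 0 (κ ^ 3), ‖contL2 (r t)‖ ≤ (η + κ * C) / κ ^ 3 := by
    intro t ht
    refine norm_contL2_le fun x => ?_
    -- The rescaled time is the parameter `s` of the uniform remainder bound.
    have hs : (κ ^ 3)⁻¹ * t ∈ Icc (0 : ℝ) 1 := by
      rw [inv_mul_eq_div]
      exact ⟨div_nonneg ht.1 hτ.le, (div_le_one hτ).2 ht.2⟩
    simp only [r, ContinuousMap.curry_apply, ContinuousMap.coe_mk]
    rw [norm_mul, norm_mul, norm_cis, one_mul, Complex.norm_real, norm_inv,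
      Real.norm_of_nonneg hτ.le, inv_mul_eq_div]
    refine div_le_div_of_nonneg_right ((norm_add_le _ _).trans (add_le_add ?_ ?_)) hτ.le
    · have := hη x
      rw [mul_assoc, norm_mul, Complex.norm_I, one_mul]
      push_cast at this
      exact this
    · rw [norm_mul, Complex.norm_real, Real.norm_of_nonneg hκ0.le]
      exact mul_le_mul_of_nonneg_left (hC κ ⟨hκ0.le, hκ.2⟩ _ hs x) hκ0.le
  have hPM : ‖mulL2 P‖ ≤ M / κ ^ 3 := by
    refine norm_mulL2_le fun x => ?_
    rw [hP, norm_mul, Complex.norm_I, one_mul, Complex.norm_real, norm_mul, norm_inv,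
      Real.norm_of_nonneg hτ.le, inv_mul_eq_div]
    exact div_le_div_of_nonneg_right (hM x) hτ.le
  have h := hψs.norm_sub_le hPM hψ
    ((contL2.continuous.comp w.continuous).continuousOn)
    ((contL2.continuous.comp r.continuous).continuousOn) hs hr (t := κ ^ 3) ⟨hτ.le, le_rfl⟩
  have e0 : w 0 = e₀ := by
    ext x
    rw [he₀]
    simp [w, cis]
  have e1 : w (κ ^ 3) = e₁ := by
    ext x
    rw [he₁]
    simp [w, cis, hκ0.ne']
  simp only [Function.comp_apply] at h
  rwa [e0, e1] at h

end OscillatingSolutions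

/-! ### Approximation by trigonometric polynomials. -/

section SmoothApproximation

theorem torusContDiff_of_mem_span {f : C(Torus, ℂ)}
    (hf : f ∈ Submodule.span ℂ (range (fourier (T := 2 * Real.pi)))) :
    TorusContDiff (⊤ : ℕ∞) f := by
  induction hf using Submodule.span_induction with
  | mem x hx =>
    obtain ⟨n, rfl⟩ := hx
    exact torusContDiff_fourier n
  | zero => exact contDiff_const
  | add x y _ _ hx hy => exact ContDiff.add hx hy
  | smul c x _ hx => exact ContDiff.const_smul c hx

theorem exists_smooth_norm_sub_lt {δ : ℝ} (hδ : 0 < δ) (ψ : L2T) :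
    ∃ f : C(Torus, ℂ), TorusContDiff (⊤ : ℕ∞) f ∧ ‖ψ - contL2 f‖ < δ := by
  have hψ : ψ ∈ (Submodule.span ℂ (range (fourierLp (T := 2 * Real.pi) 2))).topologicalClosure := by
    rw [span_fourierLp_closure_eq_top (by simp)]; trivial
  obtain ⟨y, hy, hψy⟩ := Metric.mem_closure_iff.1 hψ δ hδ
  have e : range (fourierLp (T := 2 * Real.pi) 2) = contL2 '' range fourier := by
    rw [← range_comp]; rfl
  rw [e] at hy
  have hy' : y ∈ (Submodule.span ℂ (range (fourier (T := 2 * Real.pi)))).map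
      (contL2 : C(Torus, ℂ) →ₗ[ℂ] L2T) := by
    rw [Submodule.map_span]; exact hy
  obtain ⟨f, hf, rfl⟩ := hy'
  exact ⟨f, torusContDiff_of_mem_span hf, by rw [← dist_eq_norm]; exact hψy⟩

theorem exists_smooth_abs_sub_le {δ : ℝ} (hδ : 0 < δ) {h : Torus → ℝ} (hh : Continuous h) :
    ∃ g : Torus → ℝ, TorusContDiff (⊤ : ℕ∞) g ∧ ∀ x, |g x - h x| ≤ δ := by
  let H : C(Torus, ℂ) := ⟨fun x => (h x : ℂ), by fun_prop⟩
  have hH : H ∈ (Submodule.span ℂ (range (fourier (T := 2 * Real.pi)))).topologicalClosure := by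
    rw [span_fourier_closure_eq_top]; trivial
  obtain ⟨y, hy, hHy⟩ := Metric.mem_closure_iff.1 hH δ hδ
  refine ⟨fun x => (y x).re, Complex.reCLM.contDiff.comp (torusContDiff_of_mem_span hy),
    fun x => ?_⟩
  have h1 : ‖y x - H x‖ ≤ δ := by
    rw [← dist_eq_norm, dist_comm]
    exact (ContinuousMap.dist_apply_le_dist x).trans hHy.le
  exact (by simpa [H] using Complex.abs_re_le_norm (y x - H x) : |(y x).re - h x| ≤ _).trans h1

end SmoothApproximation

/-! ### Passage to the limit. -/

section OscillatingLimit

/-- The continuous function `e^{iθ}`. -/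
def cisC (θ : C(Torus, ℝ)) : C(Torus, ℂ) := ⟨cis θ, by unfold cis; fun_prop⟩

theorem norm_cisC (θ : C(Torus, ℝ)) (x : Torus) : ‖cisC θ x‖ = 1 := norm_cis θ x

theorem cisC_add (θ η : C(Torus, ℝ)) : cisC (θ + η) = cisC θ * cisC η := by
  ext x
  simp only [cisC, cis, ContinuousMap.coe_mk, ContinuousMap.mul_apply, ContinuousMap.add_apply]
  rw [← Complex.exp_add]
  push_cast
  ring_nf

theorem norm_cisC_sub_le (θ η : C(Torus, ℝ)) (x : Torus) :
    ‖(cisC θ - cisC η) x‖ ≤ |θ x - η x| := by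
  have e : (cisC θ - cisC η) x
      = cisC η x * (Complex.exp (Complex.I * ((θ x - η x : ℝ) : ℂ)) - 1) := by
    simp only [cisC, cis, ContinuousMap.coe_mk, ContinuousMap.sub_apply]
    rw [mul_sub, ← Complex.exp_add, mul_one]
    push_cast
    ring_nf
  rw [e, norm_mul, norm_cisC, one_mul]
  exact Real.norm_exp_I_mul_ofReal_sub_one_le

theorem phaseMul_eq_mulL2 (θ : C(Torus, ℝ)) (f : L2T) : phaseMul θ f = mulL2 (cisC θ) f := by
  refine Lp.ext ?_
  filter_upwards [phaseMul_ae θ.continuous.measurable f, mulL2_ae (cisC θ) f] with x h1 h2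
  rw [h1, h2]; rfl

/-- The estimates hold for every solution, so it is enough that the value chosen in `R` comes from
one. -/
theorem R_eq_of_isSolution {q : ℕ} {α : ℝ} {Q : Fin q → Torus → ℝ} {t : ℝ} {ψ₀ : L2T}
    {u : ℝ → Fin q → ℝ} (h : ∃ ψ : ℝ → L2T, IsSolution α Q u t ψ₀ ψ) :
    ∃ ψ : ℝ → L2T, IsSolution α Q u t ψ₀ ψ ∧ R α Q t ψ₀ u = ψ t :=
  ⟨h.choose, h.choose_spec, by rw [R, dif_pos h]⟩

theorem continuous_dotQ {q : ℕ} {Q : Fin q → Torus → ℝ} (hQ : ∀ j, Continuous (Q j))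
    (u : Fin q → ℝ) : Continuous (dotQ Q u) := by
  unfold dotQ
  fun_prop

theorem torusContDiff_dotQ {q : ℕ} {n : WithTop ℕ∞} {Q : Fin q → Torus → ℝ}
    (hQ : ∀ j, TorusContDiff n (Q j)) (u : Fin q → ℝ) : TorusContDiff n (dotQ Q u) :=
  ContDiff.sum fun j _ => contDiff_const.mul (hQ j)

theorem dotQ_smul {q : ℕ} (Q : Fin q → Torus → ℝ) (c : ℝ) (u : Fin q → ℝ) (x : Torus) :
    dotQ Q (c • u) x = c * dotQ Q u x := by
  simp [dotQ, Finset.mul_sum, mul_assoc]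

/-- The potential `i (v · Q)` as a continuous function. -/
def potential {q : ℕ} {Q : Fin q → Torus → ℝ} (hQ : ∀ j, Continuous (Q j)) (v : Fin q → ℝ) :
    C(Torus, ℂ) :=
  ⟨fun x => Complex.I * (dotQ Q v x : ℂ), by
    have := continuous_dotQ hQ v
    fun_prop⟩

/-- Rates of order `1/τ` over a time `τ` give a bound independent of `τ`. -/
theorem gronwallBound_rescaled {δ M η τ : ℝ} (hM : M ≠ 0) (hτ : τ ≠ 0) :
    gronwallBound δ (M / τ) (η / τ) τ = δ * Real.exp M + η / M * (Real.exp M - 1) := by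
  rw [gronwallBound_of_K_ne_0 (div_ne_zero hM hτ)]
  beta_reduce
  rw [div_mul_cancel₀ _ hτ, div_div_div_cancel_right₀ hτ]

theorem exists_small_time_bound {q : ℕ} (α : ℝ) {Q : Fin q → Torus → ℝ}
    (hQ : ∀ j, TorusContDiff (⊤ : ℕ∞) (Q j)) (ψ₀ : L2T) (u : Fin q → ℝ)
    {φ : Torus → ℝ} (hφ : TorusContDiff 3 φ) {ε : ℝ} (hε : 0 < ε) :
    ∃ κ₀ > 0, ∀ κ ∈ Ioo (0 : ℝ) κ₀,
      ‖phaseMul (fun x => κ⁻¹ * φ x) (R α Q (κ ^ 3) (phaseMul (fun x => -(κ⁻¹ * φ x)) ψ₀)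
          (fun _ => (κ ^ 3)⁻¹ • u))
        - phaseMul (fun x => -(torusDeriv φ x) ^ 3 + dotQ Q u x) ψ₀‖ < ε := by
  have hφ3 := hφ.hasThreeDerivs
  have hφc := hφ.continuous
  have hφ'c := hφ3.second.continuous
  have hQc := fun j => (hQ j).continuous
  have hVc := continuous_dotQ hQc u
  obtain ⟨M, hM0, hM⟩ : ∃ M : ℝ, 0 < M ∧ ∀ x, |dotQ Q u x| ≤ M := by
    obtain ⟨M, hM⟩ := (isCompact_univ (X := Torus)).exists_bound_of_continuousOn hVc.continuousOn
    exact ⟨max M 1, lt_max_of_lt_right one_pos,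
      fun x => (hM x (mem_univ x)).trans (le_max_left _ _)⟩
  have hexp : 0 ≤ Real.exp M - 1 := sub_nonneg.2 (Real.one_le_exp hM0.le)
  -- `N` collects the errors in units of `δ`: initial datum, residual (`η` and `κC`, one `δ` each),
  -- `f` against `ψ₀` at the end, and `G` against `Θ` acting on `ψ₀`.
  set N := Real.exp M + 2 / M * (Real.exp M - 1) + 1 + ‖ψ₀‖ with hN
  have hN0 : 0 < N := by positivity
  set δ := ε / (2 * N) with hδdef
  have hδ : 0 < δ := by positivity
  obtain ⟨f, hf, hfψ⟩ := exists_smooth_norm_sub_lt hδ ψ₀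
  -- The bound `δ` serves to compare the final phases, and `δ / (‖f‖ + 1)` the residual, where the
  -- error multiplies `f`.
  obtain ⟨g, hg, hgφ⟩ := exists_smooth_abs_sub_le (δ := min δ (δ / (‖f‖ + 1)))
    (lt_min hδ (by positivity)) (hφ'c.pow 3).neg
  let G : C(Torus, ℝ) := ⟨fun x => g x + dotQ Q u x, hg.continuous.add hVc⟩
  let Θ : C(Torus, ℝ) := ⟨fun x => -(torusDeriv φ x) ^ 3 + dotQ Q u x,
    (hφ'c.pow 3).neg.add hVc⟩
  have hG3 : TorusContDiff 3 G :=
    (ContDiff.add hg (torusContDiff_dotQ hQ u)).of_le (WithTop.coe_le_coe.2 (le_top : (3 : ℕ∞) ≤ ⊤))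
  have hf3 : TorusContDiff 3 f := ContDiff.of_le hf (WithTop.coe_le_coe.2 (le_top : (3 : ℕ∞) ≤ ⊤))
  have hη : ∀ x, ‖((G x - dotQ Q u x + torusDeriv φ x ^ 3 : ℝ) : ℂ) * f x‖ ≤ δ := by
    intro x
    have h1 : |g x - -(torusDeriv φ x ^ 3)| ≤ δ / (‖f‖ + 1) := (hgφ x).trans (min_le_right _ _)
    have h2 : G x - dotQ Q u x + torusDeriv φ x ^ 3 = g x - -(torusDeriv φ x ^ 3) := by
      simp only [G, ContinuousMap.coe_mk]; ring
    rw [h2, norm_mul, Complex.norm_real, Real.norm_eq_abs]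
    refine (mul_le_mul h1 ((f.norm_coe_le_norm x).trans (by linarith : ‖f‖ ≤ ‖f‖ + 1))
      (norm_nonneg _) (by positivity)).trans (le_of_eq ?_)
    exact div_mul_cancel₀ _ (by positivity)
  obtain ⟨C, hC⟩ := exists_oscillating_estimate α hφ3 hG3.hasThreeDerivs hf3.hasThreeDerivs
    hVc hM hη
  refine ⟨min 1 (δ / (|C| + 1)), lt_min one_pos (by positivity), fun κ hκ => ?_⟩
  have hκ0 : 0 < κ := hκ.1
  have hκ1 : κ ≤ 1 := (hκ.2.trans_le (min_le_left _ _)).le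
  have hκC : κ * C ≤ δ := by
    have h1 : κ * (|C| + 1) ≤ δ :=
      (le_div_iff₀ (by positivity)).1 (hκ.2.trans_le (min_le_right _ _)).le
    have h2 : κ * C ≤ κ * (|C| + 1) :=
      mul_le_mul_of_nonneg_left ((le_abs_self C).trans (by linarith)) hκ0.le
    exact h2.trans h1
  have hτ : 0 < κ ^ 3 := pow_pos hκ0 3
  let Φ : C(Torus, ℝ) := ⟨fun x => κ⁻¹ * φ x, continuous_const.mul hφc⟩
  have hPot : ∀ x, potential hQc ((κ ^ 3)⁻¹ • u) x
      = Complex.I * (dotQ Q ((κ ^ 3)⁻¹ • u) x : ℂ) := fun x => rfl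
  obtain ⟨ψ, hψ, hR⟩ := R_eq_of_isSolution (α := α) (Q := Q) (t := κ ^ 3)
    (ψ₀ := phaseMul (-Φ : C(Torus, ℝ)) ψ₀) (u := fun _ => (κ ^ 3)⁻¹ • u)
    (by
      obtain ⟨ψ, hψ, -⟩ := wellPosed_of_nonneg (α := α) hτ.le hPot (phaseMul (-Φ : C(Torus, ℝ)) ψ₀)
      exact ⟨ψ, hψ⟩)
  obtain ⟨hψc, hψ0, hψs⟩ := (isSolution_iff_solvesDiag hPot).1 hψ
  have hest := hC κ ⟨hκ0, hκ1⟩ (potential hQc ((κ ^ 3)⁻¹ • u)) (cisC (-Φ) * f) (cisC (-Φ + G) * f)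
    (fun x => by rw [hPot, dotQ_smul])
    (fun x => by simp [cisC, cis, Φ])
    (fun x => by simp [cisC, cis, Φ]) ψ hψc hψs
  rw [gronwallBound_rescaled hM0.ne' hτ.ne', hψ0, phaseMul_eq_mulL2, ← mulL2_contL2,
    ← mulL2_contL2, ← map_sub,
    norm_mulL2_of_norm_eq_one (norm_cisC _)] at hest
  have hbound : ‖ψ (κ ^ 3) - mulL2 (cisC (-Φ + G)) (contL2 f)‖
      ≤ δ * (Real.exp M + 2 / M * (Real.exp M - 1)) := by
    refine hest.trans ?_
    have h1 : ‖ψ₀ - contL2 f‖ * Real.exp M ≤ δ * Real.exp M :=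
      mul_le_mul_of_nonneg_right hfψ.le (Real.exp_pos M).le
    have h2 : (δ + κ * C) / M * (Real.exp M - 1) ≤ (2 * δ) / M * (Real.exp M - 1) :=
      mul_le_mul_of_nonneg_right (div_le_div_of_nonneg_right (by linarith) hM0.le) hexp
    refine (add_le_add h1 h2).trans (le_of_eq ?_)
    ring
  have hlim : ‖mulL2 (cisC (-Φ + G)) (contL2 f) - mulL2 (cisC (-Φ + Θ)) ψ₀‖
      ≤ δ + δ * ‖ψ₀‖ := by
    have e : mulL2 (cisC (-Φ + G)) (contL2 f) - mulL2 (cisC (-Φ + Θ)) ψ₀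
        = mulL2 (cisC (-Φ + G)) (contL2 f - ψ₀)
          + mulL2 (cisC (-Φ + G) - cisC (-Φ + Θ)) ψ₀ := by
      rw [map_sub, mulL2_sub]; abel
    rw [e]
    refine (norm_add_le _ _).trans (add_le_add ?_ (norm_mulL2_apply_le (fun x => ?_) ψ₀))
    · rw [norm_mulL2_of_norm_eq_one (norm_cisC _), norm_sub_rev]
      exact hfψ.le
    · refine (norm_cisC_sub_le _ _ x).trans ?_
      have h2 : (-Φ + G) x - (-Φ + Θ) x = g x - -(torusDeriv φ x ^ 3) := by
        simp only [G, Θ, ContinuousMap.coe_mk, ContinuousMap.add_apply]; ring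
      rw [h2]
      exact (hgφ x).trans (min_le_left _ _)
  change ‖phaseMul Φ (R α Q (κ ^ 3) (phaseMul (-Φ : C(Torus, ℝ)) ψ₀) (fun _ => (κ ^ 3)⁻¹ • u))
    - phaseMul Θ ψ₀‖ < ε
  -- The outer factor `e^{iΦ}` is unitary, so it can be moved onto the target and dropped from the
  -- norm.
  have hΘ : cisC Θ = cisC Φ * cisC (-Φ + Θ) := by
    rw [← cisC_add, add_neg_cancel_left]
  rw [hR, phaseMul_eq_mulL2, phaseMul_eq_mulL2, hΘ, ← mulL2_mulL2, ← map_sub,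
    norm_mulL2_of_norm_eq_one (norm_cisC _)]
  calc ‖ψ (κ ^ 3) - mulL2 (cisC (-Φ + Θ)) ψ₀‖
      ≤ _ := norm_sub_le_norm_sub_add_norm_sub _ (mulL2 (cisC (-Φ + G)) (contL2 f)) _
    _ ≤ δ * (Real.exp M + 2 / M * (Real.exp M - 1)) + (δ + δ * ‖ψ₀‖) := add_le_add hbound hlim
    _ = ε / 2 := by
      rw [hδdef]
      have : δ * N = ε / 2 := by rw [hδdef]; field_simp
      rw [← this, hN]; ring
    _ < ε := by linarith

end OscillatingLimit

end KdVSch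

end

theorem proposition3p1 {q : ℕ} (α : ℝ) (Q : Fin q → KdVSch.Torus → ℝ)
    (hQ : ∀ j, KdVSch.TorusContDiff (⊤ : ℕ∞) (Q j))
    (ψ₀ : KdVSch.L2T) (u : Fin q → ℝ)
    (φ : KdVSch.Torus → ℝ) (hφ : KdVSch.TorusContDiff 3 φ) :
    (∀ τ : ℝ, 0 < τ →
      KdVSch.WellPosed α Q (fun _ => τ⁻¹ • u) τ
        (KdVSch.phaseMul (fun x => -(τ ^ (-(1 / 3) : ℝ) * φ x)) ψ₀)) ∧
    Tendsto
      (fun τ : ℝ =>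
        KdVSch.phaseMul (fun x => τ ^ (-(1 / 3) : ℝ) * φ x)
          (KdVSch.R α Q τ
            (KdVSch.phaseMul (fun x => -(τ ^ (-(1 / 3) : ℝ) * φ x)) ψ₀)
            (fun _ => τ⁻¹ • u)))
      (𝓝[>] 0)
      (𝓝 (KdVSch.phaseMul
        (fun x => -(KdVSch.torusDeriv φ x) ^ 3 + KdVSch.dotQ Q u x) ψ₀)) := by
  refine ⟨fun τ hτ => KdVSch.wellPosed_of_nonneg hτ.le
    (P := KdVSch.potential (fun j => (hQ j).continuous) (τ⁻¹ • u)) (fun x => rfl) _, ?_⟩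
  rw [Metric.tendsto_nhds]
  intro ε hε
  obtain ⟨κ₀, hκ₀, h⟩ := KdVSch.exists_small_time_bound α hQ ψ₀ u hφ hε
  filter_upwards [Ioo_mem_nhdsGT (pow_pos hκ₀ 3)] with τ hτ
  -- The uniform estimate is used with `κ = τ^(1/3)`.
  have hκ : 0 < τ ^ (1 / 3 : ℝ) := Real.rpow_pos_of_pos hτ.1 _
  have hκ3 : (τ ^ (1 / 3 : ℝ)) ^ 3 = τ := by
    rw [← Real.rpow_natCast, ← Real.rpow_mul hτ.1.le]
    norm_num
  have hlt : τ ^ (1 / 3 : ℝ) < κ₀ := lt_of_pow_lt_pow_left₀ 3 hκ₀.le (by rw [hκ3]; exact hτ.2)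
  have h1 := h _ ⟨hκ, hlt⟩
  rwa [hκ3, ← Real.rpow_neg hτ.1.le, ← dist_eq_norm] at h1
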